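/- **Setting.** Let $d\ge 2$. Let $(\Omega,\mathcal A,P)$ be a probability space and $X:\Omega\to\mathbb R^d$ a random variable whose distribution has a smooth density $p:\mathbb R^d\to[0,\infty)$ with compact support $\mathbb X=\operatorname{supp}p$, strictly positive in the interior of $\mathbb X$. Let $\Gamma:[0,\ell]\to\mathbb X$ ($\ell>0$) be smooth, injective and parameterized by arc-length. Let $\lambda_\Gamma(x)$ be the largest $s\in[0,\ell]$ with $\|x-\Gamma(s)\|=\min_t\|x-\Gamma(t)\|$, and let $\mathcal A_\Gamma$ be the set of points with more than one closest point on $\Gamma$. The curve $\Gamma$ is *self-consistent* with respect to $X$ if $\mathbb E[X\mid\lambda_\Gamma(X)=s]=\Gamma(s)$ for $P_{\lambda_\Gamma(X)}$-almost every $s$. For $\theta\in\mathbb R^{d-1}$ let $$T(\theta)=(\cos\theta_1,\ \sin\theta_1\cos\theta_2,\ \dots,\ \sin\theta_1\cdots\sin\theta_{d-2}\cos\theta_{d-1},\ \sin\theta_1\cdots\sin\theta_{d-2}\sin\theta_{d-1})^{\mathrm T},$$ let $T_{\theta_i}=\partial T/\partial\theta_i$, and $N_i(\theta)=T_{\theta_i}(\theta)/\|T_{\theta_i}(\theta)\|$.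 Assume that $\Gamma'(s)=T(\zeta(s))$ on $[0,\ell]$ for a smooth $\zeta:[0,\ell]\to\mathbb R^{d-1}$ with $\zeta_k(s)\in(0,\pi)$ for $1\le k\le d-2$ and all $s$. Put $$\nu(s,u)=\Gamma(s)+\sum_{i=1}^{d-1}u_iN_i(\zeta(s)),\qquad \mu(x)=\big(\lambda_\Gamma(x),\ (\langle x-\Gamma(\lambda_\Gamma(x)),N_i(\zeta(\lambda_\Gamma(x)))\rangle)_{i=1}^{d-1}\big).$$ Assume that $\nu$ is a diffeomorphism on $\mathbb X\setminus\mathcal A_\Gamma$, meaning that $\nu(\mu(x))=x$ for all $x\in\mathbb X\setminus\mathcal A_\Gamma$, that $\mu$ is differentiable on $\mathbb X\setminus\mathcal A_\Gamma$ and that $\nu$ is differentiable on its image under $\mu$. Let $R(s)=\{u\in\mathbb R^{d-1}:\lambda_\Gamma(\nu(s,u))=s,\ \nu(s,u)\notin\mathcal A_\Gamma\}$, and for a multi-index $j\in\mathbb N_0^{d-1}$ let $$\mu_j(s)=\int_{R(s)}u^j\,p(\nu(s,u))\,du .$$ Where $\mu_0(s)\ne0$, let $$v_\perp(s)=\Big(\frac{\mu_{e_i}(s)}{\mu_0(s)}\Big)_{i=1}^{d-1},\qquad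 \mathrm{cov}_\perp(s)=\Big(\frac{\mu_{e_i+e_j}(s)}{\mu_0(s)}\Big)_{i,j=1}^{d-1}-v_\perp(s)v_\perp(s)^{\mathrm T}$$ be the mean and the covariance matrix of the transverse density $u\mapsto p(\nu(s,u))/\mu_0(s)$ on $R(s)$. Let $D(s)=\operatorname{diag}(\|T_{\zeta_1}(\zeta(s))\|,\dots,\|T_{\zeta_{d-1}}(\zeta(s))\|)$. **Theorem.** The matrix $D(s)$ is invertible for every $s\in[0,\ell]$; $\mu_0(s)>0$ for every $s\in[0,\ell]$ for which $\Gamma(s)$ is an interior point of $\mathbb X$; and $\mathrm{cov}_\perp(s)+v_\perp(s)v_\perp(s)^{\mathrm T}$ is invertible for every $s\in[0,\ell]$ with $\mu_0(s)\ne0$. Moreover, $\Gamma$ is self-consistent with respect to $X$ if and only if $(\Gamma,\zeta)$ solves $$\Gamma'(s)=T(\zeta(s)),\qquad \zeta'(s)=D(s)^{-1}\big(\mathrm{cov}_\perp(s)+v_\perp(s)v_\perp(s)^{\mathrm T}\big)^{-1}v_\perp(s),$$ where the first equation is required for all $s\in[0,\ell]$ and the second for all $s\in[0,\ell]$ at which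 the transverse density exists, that is, $\mu_0(s)\ne0$. -/

import Mathlib

open MeasureTheory Set
open scoped ContDiff Matrix

noncomputable section

namespace PrincipalCurve

/-- The ambient space `ℝ^d` with `d = n + 1` and its Euclidean norm. -/
abbrev E (n : ℕ) : Type := EuclideanSpace ℝ (Fin (n + 1))

variable {n : ℕ}

/-- A smooth Jordan curve `Γ : [0, ℓ] → ℝ^d` parameterized by arc-length
(only the values of `Γ` on `[0, ℓ]` matter). -/
structure IsSmoothJordanCurve (Γ : ℝ → E n) (ℓ : ℝ) : Prop where
  length_pos : 0 < ℓ
  smooth : ContDiffOn ℝ ∞ Γ (Icc 0 ℓ)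
  injOn : InjOn Γ (Icc 0 ℓ)
  arclength : ∀ s ∈ Icc 0 ℓ, ‖derivWithin Γ (Icc 0 ℓ) s‖ = 1

/-- The parameters `s ∈ [0, ℓ]` for which `Γ s` is a point of the curve closest to `x`. -/
def nearestParams (Γ : ℝ → E n) (ℓ : ℝ) (x : E n) : Set ℝ :=
  {s ∈ Icc 0 ℓ | dist x (Γ s) = Metric.infDist x (Γ '' Icc 0 ℓ)}

/-- The ambiguity points: those with several closest points on the curve. -/
def ambiguityPoints (Γ : ℝ → E n) (ℓ : ℝ) : Set (E n) :=
  {x | ∃ s ∈ nearestParams Γ ℓ x, ∃ t ∈ nearestParams Γ ℓ x, Γ s ≠ Γ t}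

/-- The projection index `λ_Γ`. -/
def projIndex (Γ : ℝ → E n) (ℓ : ℝ) (x : E n) : ℝ := sSup (nearestParams Γ ℓ x)

/-- The curve is self-consistent with respect to `X`: the factorization `φ` of the conditional
expectation of `X` given `λ_Γ ∘ X`, that is `φ s = 𝔼[X | λ_Γ(X) = s]`, agrees with `Γ`
almost everywhere for the distribution of `λ_Γ ∘ X`. -/
def SelfConsistent {Ω : Type*} [MeasurableSpace Ω] (P : Measure Ω) (X : Ω → E n)
    (Γ : ℝ → E n) (ℓ : ℝ) : Prop :=
  ∃ φ : ℝ → E n, Measurable φ ∧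
    P[X | MeasurableSpace.comap (fun w => projIndex Γ ℓ (X w)) (borel ℝ)]
      =ᵐ[P] (fun w => φ (projIndex Γ ℓ (X w))) ∧
    ∀ᵐ s ∂(P.map (fun w => projIndex Γ ℓ (X w))), φ s = Γ s

/-- The point of the unit sphere with spherical coordinates `θ`; with indices from `0` to `n`,
its `i`-th coordinate is `sin θ₀ ⋯ sin θᵢ₋₁ cos θᵢ` for `i < n`, and `sin θ₀ ⋯ sin θₙ₋₁`
for `i = n`. -/
def sphericalTangent (θ : Fin n → ℝ) : E n :=
  WithLp.toLp 2 fun i : Fin (n + 1) =>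
    (∏ j : Fin n with j.castSucc < i, Real.sin (θ j)) *
      (if h : (i : ℕ) < n then Real.cos (θ ⟨i, h⟩) else 1)

/-- The partial derivative of the spherical parameterization in its `i`-th coordinate. -/
def sphericalPartial (θ : Fin n → ℝ) (i : Fin n) : E n :=
  fderiv ℝ (sphericalTangent (n := n)) θ (Pi.single i 1)

/-- The normal vectors `N_i` of the frame given by spherical coordinates. -/
def frameNormal (θ : Fin n → ℝ) (i : Fin n) : E n :=
  ‖sphericalPartial θ i‖⁻¹ • sphericalPartial θ i

/-- The tangent of `Γ` is represented by the smooth spherical coordinates `ζ`, which stay away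
from the singular values `0` and `π` in all coordinates but the last. -/
structure IsSphericalRepresentation (Γ : ℝ → E n) (ℓ : ℝ) (ζ : ℝ → Fin n → ℝ) : Prop where
  smooth : ContDiffOn ℝ ∞ ζ (Icc 0 ℓ)
  tangent : ∀ s ∈ Icc 0 ℓ, derivWithin Γ (Icc 0 ℓ) s = sphericalTangent (ζ s)
  regular : ∀ s ∈ Icc 0 ℓ, ∀ k : Fin n, (k : ℕ) + 1 < n → ζ s k ∈ Ioo 0 Real.pi

/-- The normal coordinate map `ν_Γ`. -/
def normalMap (Γ : ℝ → E n) (ζ : ℝ → Fin n → ℝ) (q : ℝ × (Fin n → ℝ)) : E n :=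
  Γ q.1 + ∑ i, q.2 i • frameNormal (ζ q.1) i

/-- The normal coordinate transformation `μ_Γ`. -/
def normalCoords (Γ : ℝ → E n) (ℓ : ℝ) (ζ : ℝ → Fin n → ℝ) (x : E n) : ℝ × (Fin n → ℝ) :=
  (projIndex Γ ℓ x,
    fun i => inner ℝ (x - Γ (projIndex Γ ℓ x)) (frameNormal (ζ (projIndex Γ ℓ x)) i))

/-- The normal coordinate map is a diffeomorphism on the non-ambiguous points of `𝕏`: it inverts
the normal coordinate transformation there, and both are differentiable. -/
structure IsNormalDiffeo (Γ : ℝ → E n) (ℓ : ℝ) (ζ : ℝ → Fin n → ℝ) (𝕏 : Set (E n)) : Prop where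
  leftInv : ∀ x ∈ 𝕏 \ ambiguityPoints Γ ℓ, normalMap Γ ζ (normalCoords Γ ℓ ζ x) = x
  differentiable_coords : DifferentiableOn ℝ (normalCoords Γ ℓ ζ) (𝕏 \ ambiguityPoints Γ ℓ)
  differentiable_map : DifferentiableOn ℝ (normalMap Γ ζ)
    (normalCoords Γ ℓ ζ '' (𝕏 \ ambiguityPoints Γ ℓ))

/-- The set `R(s)` of normal coordinates of the non-ambiguous points projected to `Γ s`. -/
def crossSection (Γ : ℝ → E n) (ℓ : ℝ) (ζ : ℝ → Fin n → ℝ) (s : ℝ) : Set (Fin n → ℝ) :=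
  {u | projIndex Γ ℓ (normalMap Γ ζ (s, u)) = s ∧ normalMap Γ ζ (s, u) ∉ ambiguityPoints Γ ℓ}

/-- The transverse moment `μ_j(s)` of the density `p`, for a multi-index `j`. -/
def transverseMoment (p : E n → ℝ) (Γ : ℝ → E n) (ℓ : ℝ) (ζ : ℝ → Fin n → ℝ)
    (j : Fin n → ℕ) (s : ℝ) : ℝ :=
  ∫ u in crossSection Γ ℓ ζ s, (∏ i, u i ^ j i) * p (normalMap Γ ζ (s, u))

/-- The mean `v_⊥(s)` of the transverse density. -/
def transverseMean (p : E n → ℝ) (Γ : ℝ → E n) (ℓ : ℝ) (ζ : ℝ → Fin n → ℝ)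
    (s : ℝ) : Fin n → ℝ :=
  fun i => transverseMoment p Γ ℓ ζ (Pi.single i 1) s / transverseMoment p Γ ℓ ζ 0 s

/-- The covariance matrix `cov_⊥(s)` of the transverse density. -/
def transverseCov (p : E n → ℝ) (Γ : ℝ → E n) (ℓ : ℝ) (ζ : ℝ → Fin n → ℝ)
    (s : ℝ) : Matrix (Fin n) (Fin n) ℝ :=
  Matrix.of (fun i j =>
      transverseMoment p Γ ℓ ζ (Pi.single i 1 + Pi.single j 1) s /
        transverseMoment p Γ ℓ ζ 0 s)
    - Matrix.vecMulVec (transverseMean p Γ ℓ ζ s) (transverseMean p Γ ℓ ζ s)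

/-- The matrix `cov_⊥(s) + v_⊥(s) v_⊥(s)ᵀ`. -/
def odeMatrix (p : E n → ℝ) (Γ : ℝ → E n) (ℓ : ℝ) (ζ : ℝ → Fin n → ℝ)
    (s : ℝ) : Matrix (Fin n) (Fin n) ℝ :=
  transverseCov p Γ ℓ ζ s
    + Matrix.vecMulVec (transverseMean p Γ ℓ ζ s) (transverseMean p Γ ℓ ζ s)

/-- The diagonal matrix `D` of the norms of the partial derivatives. -/
def scaleMatrix (θ : Fin n → ℝ) : Matrix (Fin n) (Fin n) ℝ :=
  Matrix.diagonal fun i => ‖sphericalPartial θ i‖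

/-- The pair `(Γ, ζ)` solves `Γ' = T(ζ)`, `ζ' = D⁻¹ (cov_⊥ + v_⊥ v_⊥ᵀ)⁻¹ v_⊥` on `[0, ℓ]`.
The second equation is imposed where its right-hand side is defined, which is where the
transverse density, being normalized by `μ_0(s)`, exists. -/
structure SolvesODE (p : E n → ℝ) (Γ : ℝ → E n) (ℓ : ℝ) (ζ : ℝ → Fin n → ℝ) : Prop where
  curve : ∀ s ∈ Icc 0 ℓ, HasDerivWithinAt Γ (sphericalTangent (ζ s)) (Icc 0 ℓ) s
  angles : ∀ s ∈ Icc 0 ℓ, transverseMoment p Γ ℓ ζ 0 s ≠ 0 →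
    HasDerivWithinAt ζ
      ((scaleMatrix (ζ s))⁻¹ *ᵥ ((odeMatrix p Γ ℓ ζ s)⁻¹ *ᵥ transverseMean p Γ ℓ ζ s))
      (Icc 0 ℓ) s

end PrincipalCurve

end

noncomputable section

namespace PrincipalCurve

open Filter Topology

/-! Write `λ` for `projIndex`, `ν` for `normalMap`, `T`, `N_i` for tangent and normals.
Self-consistency says that the residual `x - Γ (λ x)` integrates to zero against `p` over the
`λ`-preimage of every Borel set (`selfConsistent_iff`). In normal coordinates the residual is `∑ u_i
N_i`, and the Jacobian of `ν` is `1 - ∑ u_j κ_j`, where `κ = D ζ'` is the curvature vector in the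
normal frame. Change of variables and Fubini turn the condition into the vanishing of `μ_{e_i} - ∑_j
μ_{e_i+e_j} κ_j` for every `i` and almost every `s`. These functions are continuous on `(0, ℓ)`, so
they vanish there everywhere. Dividing by `μ_0` gives `v_⊥ = (cov_⊥ + v_⊥ v_⊥ᵀ) D ζ'`, which is the
second equation once both matrices are inverted. Where `μ_0 = 0`, no part of the slice carries
density and there is nothing to check.

The analytic burden is the domain of the change of variables. Ambiguity points are null by
Rademacher's theorem (`volume_ambiguityPoints`). The endpoints of the curve receive no unambiguous
point of positive density, since such a point could be pushed along the tangent and then violate `ν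
(μ x) = x` (`projIndex_mem_Ioo`). Differentiability of `λ` forbids a zero Jacobian
(`defectSlope_ne_zero`), and second-order minimality fixes its sign; together they make
`normalDomain` open (`isOpen_normalDomain`). Continuity in `s` is dominated convergence, using that
the cells of the projection are convex and so have null frontier (`ae_continuousAt_sliceDensity`).
The second-moment matrix is invertible because its density is positive on a nonempty open set
(`isUnit_odeMatrix`). -/

/-! ### Spherical coordinates and the orthonormal frame. -/

theorem sphericalTangent_zero {n : ℕ} (θ : Fin (n + 1) → ℝ) :
    sphericalTangent θ 0 = Real.cos (θ 0) := by
  simp [sphericalTangent]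

/-- Peeling off the first angle, `T(θ) = (cos θ₀, sin θ₀ T(tail θ))`, is the recursion behind the
inductions on `n` below. -/
theorem sphericalTangent_succ {n : ℕ} (θ : Fin (n + 1) → ℝ) (k : Fin (n + 1)) :
    sphericalTangent θ k.succ = Real.sin (θ 0) * sphericalTangent (Fin.tail θ) k := by
  simp only [sphericalTangent, Finset.prod_filter, Fin.prod_univ_succ (n := n)]
  simp [Fin.tail, mul_assoc]

theorem contDiff_sphericalTangent {n : ℕ} : ContDiff ℝ ∞ (sphericalTangent (n := n)) := by
  unfold sphericalTangent
  refine (PiLp.contDiff_toLp).comp (contDiff_pi.2 fun i => ?_)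
  refine ContDiff.mul (contDiff_prod fun j _ => Real.contDiff_sin.comp (contDiff_apply ℝ ℝ j)) ?_
  split_ifs with h
  · exact Real.contDiff_cos.comp (contDiff_apply ℝ ℝ _)
  · exact contDiff_const

theorem hasFDerivAt_sphericalTangent {n : ℕ} (θ : Fin n → ℝ) :
    HasFDerivAt sphericalTangent (fderiv ℝ (sphericalTangent (n := n)) θ) θ :=
  (contDiff_sphericalTangent.differentiable (by simp)).differentiableAt.hasFDerivAt

theorem hasDerivAt_sphericalTangent_apply {n : ℕ} (θ : Fin n → ℝ) (i : Fin n) (k : Fin (n + 1)) :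
    HasDerivAt (fun t : ℝ => sphericalTangent (θ + t • Pi.single i 1) k)
      (sphericalPartial θ i k) 0 := by
  have h := ((hasFDerivAt_sphericalTangent θ).hasLineDerivAt (Pi.single i 1))
  have h2 : HasDerivAt (fun t : ℝ => sphericalTangent (θ + t • Pi.single i 1))
      (sphericalPartial θ i) 0 := h
  exact ((EuclideanSpace.proj (𝕜 := ℝ) k).hasFDerivAt.comp_hasDerivAt 0 h2)

theorem sphericalPartial_zero_zero {n : ℕ} (θ : Fin (n + 1) → ℝ) :
    sphericalPartial θ 0 0 = - Real.sin (θ 0) := by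
  refine (hasDerivAt_sphericalTangent_apply θ 0 0).unique ?_
  have : HasDerivAt (fun t : ℝ => Real.cos (θ 0 + t)) (-Real.sin (θ 0 + 0)) 0 :=
    (Real.hasDerivAt_cos _).comp_const_add (θ 0) 0
  simpa [sphericalTangent_zero] using this

theorem sphericalPartial_zero_succ {n : ℕ} (θ : Fin (n + 1) → ℝ) (k : Fin (n + 1)) :
    sphericalPartial θ 0 k.succ = Real.cos (θ 0) * sphericalTangent (Fin.tail θ) k := by
  refine (hasDerivAt_sphericalTangent_apply θ 0 k.succ).unique ?_
  have : HasDerivAt (fun t : ℝ => Real.sin (θ 0 + t)) (Real.cos (θ 0 + 0)) 0 :=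
    (Real.hasDerivAt_sin _).comp_const_add (θ 0) 0
  have h : ∀ t : ℝ, Fin.tail (θ + t • (Pi.single 0 1 : Fin (n + 1) → ℝ)) = Fin.tail θ := by
    intro t; ext j; simp [Fin.tail]
  simpa [sphericalTangent_succ, h] using this.mul_const (sphericalTangent (Fin.tail θ) k)

theorem sphericalPartial_succ_zero {n : ℕ} (θ : Fin (n + 1) → ℝ) (i : Fin n) :
    sphericalPartial θ i.succ 0 = 0 := by
  refine (hasDerivAt_sphericalTangent_apply θ i.succ 0).unique ?_
  simpa [sphericalTangent_zero] using hasDerivAt_const (0 : ℝ) (Real.cos (θ 0))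

theorem sphericalPartial_succ_succ {n : ℕ} (θ : Fin (n + 1) → ℝ) (i : Fin n) (k : Fin (n + 1)) :
    sphericalPartial θ i.succ k.succ = Real.sin (θ 0) * sphericalPartial (Fin.tail θ) i k := by
  refine (hasDerivAt_sphericalTangent_apply θ i.succ k.succ).unique ?_
  have h : ∀ t : ℝ, Fin.tail (θ + t • (Pi.single i.succ 1 : Fin (n + 1) → ℝ))
      = Fin.tail θ + t • Pi.single i 1 := by
    intro t; ext j; simp [Fin.tail, Pi.single_apply]
  simpa [sphericalTangent_succ, h] using
    (hasDerivAt_sphericalTangent_apply (Fin.tail θ) i k).const_mul (Real.sin (θ 0))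

theorem inner_sphericalTangent_self {n : ℕ} (θ : Fin n → ℝ) :
    inner ℝ (sphericalTangent θ) (sphericalTangent θ) = 1 := by
  induction n with
  | zero =>
    rw [PiLp.inner_apply]
    simp [sphericalTangent]
  | succ n ih =>
    have := ih (Fin.tail θ)
    simp only [PiLp.inner_apply, Fin.sum_univ_succ (n := n + 1), sphericalTangent_zero,
      sphericalTangent_succ, RCLike.inner_apply, conj_trivial] at this ⊢
    have h2 : ∀ a b : ℝ, a * b * (a * b) = a ^ 2 * (b * b) := fun a b => by ring
    simp only [h2, ← Finset.mul_sum, this]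
    nlinarith [Real.sin_sq_add_cos_sq (θ 0)]

theorem norm_sphericalTangent {n : ℕ} (θ : Fin n → ℝ) : ‖sphericalTangent θ‖ = 1 := by
  have := real_inner_self_eq_norm_sq (sphericalTangent θ)
  rw [inner_sphericalTangent_self] at this
  nlinarith [norm_nonneg (sphericalTangent θ)]

theorem inner_sphericalPartial_tangent {n : ℕ} (θ : Fin n → ℝ) (i : Fin n) :
    inner ℝ (sphericalPartial θ i) (sphericalTangent θ) = 0 := by
  induction n with
  | zero => exact i.elim0
  | succ n ih =>
    have h1 := inner_sphericalTangent_self (Fin.tail θ)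
    induction i using Fin.cases with
    | zero =>
      simp only [PiLp.inner_apply, Fin.sum_univ_succ (n := n + 1), sphericalTangent_zero,
        sphericalTangent_succ, sphericalPartial_zero_zero, sphericalPartial_zero_succ,
        RCLike.inner_apply, conj_trivial] at h1 ⊢
      have h2 : ∀ a b c : ℝ, a * b * (c * b) = a * c * (b * b) := fun a b c => by ring
      simp only [h2, ← Finset.mul_sum, h1]
      ring
    | succ i =>
      have := ih (Fin.tail θ) i
      simp only [PiLp.inner_apply, Fin.sum_univ_succ (n := n + 1), sphericalTangent_zero,
        sphericalTangent_succ, sphericalPartial_succ_zero, sphericalPartial_succ_succ,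
        RCLike.inner_apply, conj_trivial] at this ⊢
      have h2 : ∀ a b c d : ℝ, a * b * (c * d) = a * c * (b * d) := fun a b c d => by ring
      simp only [h2, ← Finset.mul_sum, this]
      ring

theorem inner_sphericalPartial_of_ne {n : ℕ} (θ : Fin n → ℝ) {i j : Fin n} (hij : i ≠ j) :
    inner ℝ (sphericalPartial θ i) (sphericalPartial θ j) = 0 := by
  have h2 : ∀ a b c d : ℝ, a * b * (c * d) = a * c * (b * d) := fun a b c d => by ring
  induction n with
  | zero => exact i.elim0
  | succ n ih =>
    have h1 := fun i => inner_sphericalPartial_tangent (Fin.tail θ) i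
    have h3 : ∀ i : Fin n,
        inner ℝ (sphericalPartial θ i.succ) (sphericalPartial θ 0) = 0 := by
      intro i
      have := h1 i
      simp only [PiLp.inner_apply, Fin.sum_univ_succ (n := n + 1), sphericalPartial_zero_zero,
        sphericalPartial_zero_succ, sphericalPartial_succ_zero, sphericalPartial_succ_succ,
        RCLike.inner_apply, conj_trivial] at this ⊢
      simp only [h2, ← Finset.mul_sum, this]
      ring
    induction i using Fin.cases with
    | zero =>
      induction j using Fin.cases with
      | zero => exact absurd rfl hij
      | succ j => rw [real_inner_comm]; exact h3 j
    | succ i =>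
      induction j using Fin.cases with
      | zero => exact h3 i
      | succ j =>
        have := ih (Fin.tail θ) (i := i) (j := j) (fun h => hij (by rw [h]))
        simp only [PiLp.inner_apply, Fin.sum_univ_succ (n := n + 1),
          sphericalPartial_succ_zero, sphericalPartial_succ_succ,
          RCLike.inner_apply, conj_trivial] at this ⊢
        simp only [h2, ← Finset.mul_sum, this]
        ring

/-- The spherical coordinates `θ` avoid the poles in all coordinates but the last. -/
def IsRegularAngle {n : ℕ} (θ : Fin n → ℝ) : Prop :=
  ∀ k : Fin n, (k : ℕ) + 1 < n → Real.sin (θ k) ≠ 0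

/-- The first partial is `(-sin θ₀, cos θ₀ T(tail θ))`, a unit vector. Each later one is `sin θ₀`
times a partial of the tail, so only sines of earlier angles enter and the last angle is
unrestricted. -/
theorem sphericalPartial_ne_zero {n : ℕ} {θ : Fin n → ℝ} (hθ : IsRegularAngle θ) (i : Fin n) :
    sphericalPartial θ i ≠ 0 := by
  induction n with
  | zero => exact i.elim0
  | succ n ih =>
    induction i using Fin.cases with
    | zero =>
      intro h
      have hs : Real.sin (θ 0) = 0 := by
        simpa [sphericalPartial_zero_zero] using congrArg (fun v : E (n + 1) => v 0) h
      have hT : Real.cos (θ 0) • sphericalTangent (Fin.tail θ) = 0 := by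
        ext k
        simpa [sphericalPartial_zero_succ] using congrArg (fun v : E (n + 1) => v k.succ) h
      have hc : Real.cos (θ 0) = 0 := by
        simpa [norm_smul, norm_sphericalTangent] using congrArg norm hT
      have := Real.sin_sq_add_cos_sq (θ 0)
      simp [hs, hc] at this
    | succ i =>
      intro h
      refine ih (θ := Fin.tail θ) (fun k hk => hθ k.succ (by simpa using hk)) i ?_
      ext k
      have h0 : Real.sin (θ 0) ≠ 0 := hθ 0 (by simpa using i.pos)
      simpa [sphericalPartial_succ_succ, h0] using
        congrArg (fun v : E (n + 1) => v k.succ) h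

/-- The tangent followed by the normals. -/
def frame {n : ℕ} (θ : Fin n → ℝ) : Fin (n + 1) → E n :=
  Fin.cons (sphericalTangent θ) (frameNormal θ)

theorem inner_frameNormal_tangent {n : ℕ} (θ : Fin n → ℝ) (i : Fin n) :
    inner ℝ (frameNormal θ i) (sphericalTangent θ) = 0 := by
  simp [frameNormal, real_inner_smul_left, inner_sphericalPartial_tangent]

theorem inner_frameNormal_sphericalPartial {n : ℕ} (θ : Fin n → ℝ)
    (i j : Fin n) :
    inner ℝ (frameNormal θ i) (sphericalPartial θ j) =
      if i = j then ‖sphericalPartial θ j‖ else 0 := by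
  split_ifs with h
  · subst h
    rw [frameNormal, real_inner_smul_left, real_inner_self_eq_norm_sq]
    by_cases h : ‖sphericalPartial θ i‖ = 0
    · simp [h]
    · field_simp
  · rw [frameNormal, real_inner_smul_left, inner_sphericalPartial_of_ne θ h, mul_zero]

theorem inner_frameNormal {n : ℕ} {θ : Fin n → ℝ} (hθ : IsRegularAngle θ) (i j : Fin n) :
    inner ℝ (frameNormal θ i) (frameNormal θ j) = if i = j then 1 else 0 := by
  have h := norm_ne_zero_iff.2 (sphericalPartial_ne_zero hθ j)
  rw [frameNormal.eq_def θ j, real_inner_smul_right, inner_frameNormal_sphericalPartial]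
  split_ifs <;> simp [h]

theorem orthonormal_frame {n : ℕ} {θ : Fin n → ℝ} (hθ : IsRegularAngle θ) :
    Orthonormal ℝ (frame θ) := by
  rw [orthonormal_iff_ite]
  intro i j
  induction i using Fin.cases with
  | zero =>
    induction j using Fin.cases with
    | zero => simp [frame, norm_sphericalTangent]
    | succ j =>
      rw [real_inner_comm]
      simpa [frame, (Fin.succ_ne_zero j).symm] using inner_frameNormal_tangent θ j
  | succ i =>
    induction j using Fin.cases with
    | zero => simpa [frame] using inner_frameNormal_tangent θ i
    | succ j => simpa [frame] using inner_frameNormal hθ i j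

/-- The orthonormal basis formed by the tangent and the normals. -/
def frameBasis {n : ℕ} {θ : Fin n → ℝ} (hθ : IsRegularAngle θ) :
    OrthonormalBasis (Fin (n + 1)) ℝ (E n) :=
  OrthonormalBasis.mk (orthonormal_frame hθ) (by
    rw [(orthonormal_frame hθ).linearIndependent.span_eq_top_of_card_eq_finrank (by simp)])

theorem coe_frameBasis {n : ℕ} {θ : Fin n → ℝ} (hθ : IsRegularAngle θ) :
    ⇑(frameBasis hθ) = frame θ := OrthonormalBasis.coe_mk _ _

theorem inner_sum_frameNormal {n : ℕ} {θ : Fin n → ℝ} (hθ : IsRegularAngle θ) (u : Fin n → ℝ)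
    (i : Fin n) : inner ℝ (∑ j, u j • frameNormal θ j) (frameNormal θ i) = u i := by
  simp [sum_inner, real_inner_smul_left, inner_frameNormal hθ]

theorem inner_sum_frameNormal_tangent {n : ℕ} (θ : Fin n → ℝ) (u : Fin n → ℝ) :
    inner ℝ (∑ j, u j • frameNormal θ j) (sphericalTangent θ) = 0 := by
  simp [sum_inner, real_inner_smul_left, inner_frameNormal_tangent]

/-- The left side is the sup norm on `Fin n → ℝ`. The estimate bounds normal coordinates by distance
to the curve, hence by the compact support of `p`. -/
theorem norm_le_norm_sum_frameNormal {n : ℕ} {θ : Fin n → ℝ} (hθ : IsRegularAngle θ)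
    (u : Fin n → ℝ) : ‖u‖ ≤ ‖∑ j, u j • frameNormal θ j‖ := by
  refine (pi_norm_le_iff_of_nonneg (norm_nonneg _)).2 fun i => ?_
  have h1 : ‖frameNormal θ i‖ = 1 := by
    have := inner_frameNormal hθ i i
    rw [real_inner_self_eq_norm_sq] at this
    simp only [if_true] at this
    nlinarith [norm_nonneg (frameNormal θ i)]
  have := norm_inner_le_norm (𝕜 := ℝ) (∑ j, u j • frameNormal θ j) (frameNormal θ i)
  rwa [inner_sum_frameNormal hθ, h1, mul_one] at this

theorem contDiff_sphericalPartial {n : ℕ} (i : Fin n) :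
    ContDiff ℝ ∞ fun θ => sphericalPartial θ i :=
  (contDiff_sphericalTangent.fderiv_right (by simp)).clm_apply contDiff_const

theorem contDiffAt_frameNormal {n : ℕ} {θ : Fin n → ℝ} (hθ : IsRegularAngle θ) (i : Fin n) :
    ContDiffAt ℝ ∞ (fun θ => frameNormal θ i) θ := by
  have h := (contDiff_sphericalPartial i).contDiffAt (x := θ)
  have h0 := sphericalPartial_ne_zero hθ i
  exact ((h.norm ℝ h0).inv (norm_ne_zero_iff.2 h0)).smul h

theorem hasDerivWithinAt_sphericalTangent_comp {n : ℕ} {ζ : ℝ → Fin n → ℝ} {ζ' : Fin n → ℝ}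
    {S : Set ℝ} {s : ℝ} (h : HasDerivWithinAt ζ ζ' S s) :
    HasDerivWithinAt (fun t => sphericalTangent (ζ t))
      (∑ j, ζ' j • sphericalPartial (ζ s) j) S s := by
  have := (hasFDerivAt_sphericalTangent (ζ s)).comp_hasDerivWithinAt s h
  have h2 : fderiv ℝ sphericalTangent (ζ s) ζ' = ∑ j, ζ' j • sphericalPartial (ζ s) j := by
    conv_lhs => rw [pi_eq_sum_univ' ζ']
    simp only [map_sum, map_smul, sphericalPartial]
  rw [← h2]
  exact this

/-! ### Closest points, the projection index and ambiguity points. -/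

section NearestPoints

variable {n : ℕ} {Γ : ℝ → E n} {ℓ : ℝ}

theorem mem_nearestParams_iff {x : E n} {s : ℝ} :
    s ∈ nearestParams Γ ℓ x ↔ s ∈ Icc 0 ℓ ∧ ∀ t ∈ Icc 0 ℓ, dist x (Γ s) ≤ dist x (Γ t) := by
  refine and_congr_right fun hs => ⟨fun h t ht => h ▸
    Metric.infDist_le_dist_of_mem (mem_image_of_mem Γ ht), fun h => le_antisymm ?_
    (Metric.infDist_le_dist_of_mem (mem_image_of_mem Γ hs))⟩
  refine (Metric.le_infDist ⟨_, mem_image_of_mem Γ hs⟩).2 ?_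
  rintro _ ⟨t, ht, rfl⟩
  exact h t ht

theorem bddAbove_nearestParams (x : E n) : BddAbove (nearestParams Γ ℓ x) :=
  ⟨ℓ, fun _ hs => hs.1.2⟩

theorem projIndex_mem (hℓ : 0 < ℓ) (hc : ContinuousOn Γ (Icc 0 ℓ)) (x : E n) :
    projIndex Γ ℓ x ∈ nearestParams Γ ℓ x := by
  have hne : (nearestParams Γ ℓ x).Nonempty := by
    obtain ⟨_, ⟨s, hs, rfl⟩, h⟩ := (isCompact_Icc.image_of_continuousOn hc).exists_infDist_eq_dist
      ((nonempty_Icc.2 hℓ.le).image Γ) x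
    exact ⟨s, hs, h.symm⟩
  have hcl : IsClosed (nearestParams Γ ℓ x) := by
    have := ((continuous_const (y := x)).dist continuous_id
      |>.comp_continuousOn hc).preimage_isClosed_of_isClosed
      isClosed_Icc (isClosed_singleton (x := Metric.infDist x (Γ '' Icc 0 ℓ)))
    exact this
  exact hcl.csSup_mem hne (bddAbove_nearestParams x)

theorem eq_of_notMem_ambiguityPoints (hi : InjOn Γ (Icc 0 ℓ)) {x : E n}
    (hx : x ∉ ambiguityPoints Γ ℓ) {s t : ℝ} (hs : s ∈ nearestParams Γ ℓ x)
    (ht : t ∈ nearestParams Γ ℓ x) : s = t := by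
  by_contra h
  exact hx ⟨s, hs, t, ht, fun e => h (hi hs.1 ht.1 e)⟩

theorem projIndex_eq_of_unique {x : E n} {s : ℝ} (hs : s ∈ nearestParams Γ ℓ x)
    (h : ∀ t ∈ nearestParams Γ ℓ x, t = s) :
    projIndex Γ ℓ x = s ∧ x ∉ ambiguityPoints Γ ℓ := by
  have : nearestParams Γ ℓ x = {s} := Subset.antisymm h (by simpa using hs)
  refine ⟨by rw [projIndex, this, csSup_singleton], ?_⟩
  rintro ⟨a, ha, b, hb, hab⟩
  exact hab (by rw [h a ha, h b hb])

/-- As `λ` picks the largest closest parameter, `a ≤ λ x` holds exactly when the arc from `a` on is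
as close to `x` as the whole curve. This is an equality of two continuous distance functions, so it
defines a closed set. -/
theorem measurable_projIndex (hℓ : 0 < ℓ) (hc : ContinuousOn Γ (Icc 0 ℓ)) :
    Measurable (projIndex Γ ℓ) := by
  refine measurable_of_Ici fun a => ?_
  -- For `a > ℓ` the arc and the preimage are empty; for `a < 0` the truncation `max a 0` keeps the
  -- arc inside `[0, ℓ]`.
  by_cases ha : a ≤ ℓ
  · have : projIndex Γ ℓ ⁻¹' Ici a = {x | Metric.infDist x (Γ '' Icc (max a 0) ℓ)
        = Metric.infDist x (Γ '' Icc 0 ℓ)} := by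
      have hsub : Γ '' Icc (max a 0) ℓ ⊆ Γ '' Icc 0 ℓ :=
        image_mono (Icc_subset_Icc_left (le_max_right _ _))
      have hne : (Γ '' Icc (max a 0) ℓ).Nonempty :=
        (nonempty_Icc.2 (max_le ha hℓ.le)).image Γ
      ext x
      constructor
      · intro hx
        have h := projIndex_mem hℓ hc x
        refine le_antisymm ?_ (Metric.infDist_le_infDist_of_subset hsub hne)
        rw [← h.2]
        exact Metric.infDist_le_dist_of_mem
          (mem_image_of_mem Γ ⟨max_le hx h.1.1, h.1.2⟩)
      · intro hx
        obtain ⟨_, ⟨t, ht, rfl⟩, h⟩ := ((isCompact_Icc (a := max a 0)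
          (b := ℓ)).image_of_continuousOn (hc.mono (Icc_subset_Icc_left
          (le_max_right _ _)))).exists_infDist_eq_dist hne x
        have hx' : Metric.infDist x (Γ '' Icc (max a 0) ℓ)
          = Metric.infDist x (Γ '' Icc 0 ℓ) := hx
        exact (le_max_left a 0).trans (ht.1.trans (le_csSup (bddAbove_nearestParams x)
          ⟨⟨(le_max_right _ _).trans ht.1, ht.2⟩, by rw [← hx', h]⟩))
    rw [this]
    exact (isClosed_eq (Metric.continuous_infDist_pt _)
      (Metric.continuous_infDist_pt _)).measurableSet
  · have : projIndex Γ ℓ ⁻¹' Ici a = ∅ := by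
      ext x
      simpa using (projIndex_mem hℓ hc x).1.2.trans_lt (not_le.1 ha)
    rw [this]
    exact MeasurableSet.empty

/-- The distance `g` to the curve is Lipschitz, so differentiable almost everywhere. If `Γ s` is
closest to `x`, then `‖y‖² - g(y)²` lies above an affine function with gradient `2 Γ s` and touches
it at `x`. Differentiability at `x` thus determines `Γ s`. -/
theorem volume_ambiguityPoints : volume (ambiguityPoints Γ ℓ) = 0 := by
  have hd := (Metric.lipschitz_infDist_pt (Γ '' Icc 0 ℓ)).ae_differentiableAt
    (μ := (volume : Measure (E n)))
  refine measure_mono_null (fun x hx => ?_) (ae_iff.1 hd)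
  intro hdx
  set g : E n → ℝ := fun y => Metric.infDist y (Γ '' Icc 0 ℓ) with hg
  have hF : DifferentiableAt ℝ (fun y : E n => ‖y‖ ^ 2 - g y ^ 2) x :=
    differentiableAt_id.norm_sq ℝ |>.sub (hdx.pow 2)
  have key : ∀ s ∈ nearestParams Γ ℓ x,
      fderiv ℝ (fun y : E n => ‖y‖ ^ 2 - g y ^ 2) x = (2 : ℝ) • innerSL ℝ (Γ s) := by
    intro s hs
    have hmin : IsLocalMin (fun y : E n => (‖y‖ ^ 2 - g y ^ 2)
        - ((2 : ℝ) • innerSL ℝ (Γ s)) y) x := by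
      refine Eventually.of_forall fun y => ?_
      have h1 : g y ≤ dist y (Γ s) := Metric.infDist_le_dist_of_mem (mem_image_of_mem Γ hs.1)
      have h2 : g x = dist x (Γ s) := hs.2.symm
      have h0 : 0 ≤ g y := Metric.infDist_nonneg
      have h3 : ∀ z : E n, dist z (Γ s) ^ 2 =
          ‖z‖ ^ 2 - 2 * inner ℝ (Γ s) z + ‖Γ s‖ ^ 2 := by
        intro z
        rw [dist_eq_norm, norm_sub_sq_real, real_inner_comm]
      have h4 : g y ^ 2 ≤ dist y (Γ s) ^ 2 := pow_le_pow_left₀ h0 h1 2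
      simp only [h2, smul_apply, innerSL_apply_apply, smul_eq_mul]
      linarith [h3 x, h3 y]
    have := hmin.hasFDerivAt_eq_zero
      (hF.hasFDerivAt.sub ((2 : ℝ) • innerSL ℝ (Γ s)).hasFDerivAt)
    exact sub_eq_zero.1 this
  obtain ⟨s, hs, t, ht, hst⟩ := hx
  have h := (key s hs).symm.trans (key t ht)
  apply hst
  refine ext_inner_right ℝ fun v => ?_
  simpa using congrArg (fun L => L v) h

/-- Closeness of `Γ s` to `x` means `2⟨x - Γ s, Γ t - Γ s⟩ ≤ ‖Γ t - Γ s‖²`. Scaling the left side by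
`r < 1` makes this strict unless `Γ t = Γ s`. -/
theorem nearest_of_shrink (hi : InjOn Γ (Icc 0 ℓ)) {x : E n} {s : ℝ}
    (hs : s ∈ nearestParams Γ ℓ x) {r : ℝ} (h0 : 0 ≤ r) (h1 : r < 1) :
    projIndex Γ ℓ (Γ s + r • (x - Γ s)) = s ∧
      Γ s + r • (x - Γ s) ∉ ambiguityPoints Γ ℓ := by
  rw [mem_nearestParams_iff] at hs
  have key : ∀ t ∈ Icc 0 ℓ, ∀ c : ℝ, dist (Γ s + c • (x - Γ s)) (Γ t) ^ 2 =
      dist (Γ s + c • (x - Γ s)) (Γ s) ^ 2 - 2 * c * inner ℝ (x - Γ s) (Γ t - Γ s)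
        + ‖Γ t - Γ s‖ ^ 2 := by
    intro t _ c
    have e1 : Γ s + c • (x - Γ s) - Γ t = c • (x - Γ s) - (Γ t - Γ s) := by abel
    rw [dist_eq_norm, dist_eq_norm, e1, norm_sub_sq_real, real_inner_smul_left,
      add_sub_cancel_left]
    ring
  have hx : ∀ t ∈ Icc 0 ℓ, 2 * inner ℝ (x - Γ s) (Γ t - Γ s) ≤ ‖Γ t - Γ s‖ ^ 2 := by
    intro t ht
    have h := key t ht 1
    have h2 := pow_le_pow_left₀ dist_nonneg (hs.2 t ht) 2
    simp only [one_smul, add_sub_cancel] at h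
    linarith
  refine projIndex_eq_of_unique (mem_nearestParams_iff.2 ⟨hs.1, fun t ht => ?_⟩) fun t ht => ?_
  · refine (sq_le_sq₀ dist_nonneg dist_nonneg).1 ?_
    nlinarith [key t ht r, hx t ht, sq_nonneg ‖Γ t - Γ s‖]
  · rw [mem_nearestParams_iff] at ht
    have h2 := pow_le_pow_left₀ dist_nonneg (ht.2 s hs.1) 2
    have h3 : ‖Γ t - Γ s‖ ^ 2 ≤ 0 := by
      nlinarith [key t ht.1 r, hx t ht.1, sq_nonneg ‖Γ t - Γ s‖]
    have h4 : ‖Γ t - Γ s‖ = 0 := by nlinarith [norm_nonneg (Γ t - Γ s)]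
    exact hi ht.1 hs.1 (sub_eq_zero.1 (norm_eq_zero.1 h4))

/-- Upper semicontinuity of the set of closest parameters: the compact remainder of the curve is
strictly farther from `x₀`, and strict inequality of distances persists. -/
theorem eventually_nearestParams_subset (hc : ContinuousOn Γ (Icc 0 ℓ)) {x₀ : E n} {V : Set ℝ}
    (hV : IsOpen V) (h : nearestParams Γ ℓ x₀ ⊆ V) :
    ∀ᶠ x in 𝓝 x₀, nearestParams Γ ℓ x ⊆ V := by
  have hK : IsCompact (Icc 0 ℓ \ V) := isCompact_Icc.diff hV
  rcases (Icc 0 ℓ \ V).eq_empty_or_nonempty with he | hne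
  · exact Eventually.of_forall fun x s hs => sdiff_eq_empty.1 he hs.1
  · have hlt : Metric.infDist x₀ (Γ '' Icc 0 ℓ) < Metric.infDist x₀ (Γ '' (Icc 0 ℓ \ V)) := by
      obtain ⟨_, ⟨t, ht, rfl⟩, h2⟩ := (hK.image_of_continuousOn
        (hc.mono sdiff_subset)).exists_infDist_eq_dist (hne.image Γ) x₀
      rw [h2]
      refine lt_of_le_of_ne (Metric.infDist_le_dist_of_mem (mem_image_of_mem Γ ht.1)) fun e => ?_
      exact ht.2 (h ⟨ht.1, e.symm⟩)
    filter_upwards [(Metric.continuous_infDist_pt _).continuousAt.eventually_lt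
      (Metric.continuous_infDist_pt _).continuousAt hlt] with x hx s hs
    by_contra hsV
    have := Metric.infDist_le_dist_of_mem (x := x)
      (mem_image_of_mem Γ (show s ∈ Icc 0 ℓ \ V from ⟨hs.1, hsV⟩))
    rw [hs.2] at this
    exact absurd hx (not_lt.2 this)

theorem dense_compl_ambiguityPoints (hℓ : 0 < ℓ) (hc : ContinuousOn Γ (Icc 0 ℓ))
    (hi : InjOn Γ (Icc 0 ℓ)) : Dense (ambiguityPoints Γ ℓ)ᶜ := by
  intro x
  have hs := projIndex_mem hℓ hc x
  set s := projIndex Γ ℓ x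
  have hcont : Continuous fun r : ℝ => Γ s + r • (x - Γ s) := by fun_prop
  have ht : Tendsto (fun r : ℝ => Γ s + r • (x - Γ s)) (𝓝[<] 1) (𝓝 x) := by
    have := hcont.tendsto 1
    simp only [one_smul, add_sub_cancel] at this
    exact this.mono_left nhdsWithin_le_nhds
  refine mem_closure_of_tendsto ht ?_
  filter_upwards [Ioo_mem_nhdsLT (zero_lt_one (α := ℝ))] with r hr
  exact (nearest_of_shrink hi hs hr.1.le hr.2).2

end NearestPoints

/-! ### The tangential defect and openness of the normal coordinate domain. -/

/-- A curve with normal coordinates on the support of a continuous compactly supported density. -/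
structure IsAdmissible {n : ℕ} (p : E n → ℝ) (Γ : ℝ → E n) (ℓ : ℝ) (ζ : ℝ → Fin n → ℝ) : Prop where
  continuous : Continuous p
  nonneg : ∀ x, 0 ≤ p x
  compact : HasCompactSupport p
  curve : IsSmoothJordanCurve Γ ℓ
  angles : IsSphericalRepresentation Γ ℓ ζ
  diffeo : IsNormalDiffeo Γ ℓ ζ (tsupport p)

/-- The component of `x - Γ t` along the tangent. -/
def tangentialDefect {n : ℕ} (Γ : ℝ → E n) (ζ : ℝ → Fin n → ℝ) (x : E n) (t : ℝ) : ℝ :=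
  inner ℝ (x - Γ t) (sphericalTangent (ζ t))

/-- The derivative of `tangentialDefect` in the curve parameter. -/
def defectSlope {n : ℕ} (Γ : ℝ → E n) (ℓ : ℝ) (ζ : ℝ → Fin n → ℝ) (x : E n) (t : ℝ) : ℝ :=
  -1 + ∑ j, derivWithin ζ (Icc 0 ℓ) t j * inner ℝ (x - Γ t) (sphericalPartial (ζ t) j)

/-- The coordinates of the curvature vector in the normal frame. -/
def curvature {n : ℕ} (ℓ : ℝ) (ζ : ℝ → Fin n → ℝ) (t : ℝ) (j : Fin n) : ℝ :=
  derivWithin ζ (Icc 0 ℓ) t j * ‖sphericalPartial (ζ t) j‖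

/-- The normal coordinates of the non-ambiguous points at which `p` is positive and which are
projected to the open curve. -/
def normalDomain {n : ℕ} (p : E n → ℝ) (Γ : ℝ → E n) (ℓ : ℝ) (ζ : ℝ → Fin n → ℝ) :
    Set (ℝ × (Fin n → ℝ)) :=
  {q | q.1 ∈ Ioo 0 ℓ ∧ q.2 ∈ crossSection Γ ℓ ζ q.1 ∧ 0 < p (normalMap Γ ζ q)}

namespace IsAdmissible

variable {n : ℕ} {p : E n → ℝ} {Γ : ℝ → E n} {ℓ : ℝ} {ζ : ℝ → Fin n → ℝ}

theorem regular (h : IsAdmissible p Γ ℓ ζ) {s : ℝ} (hs : s ∈ Icc 0 ℓ) : IsRegularAngle (ζ s) :=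
  fun k hk => (Real.sin_pos_of_mem_Ioo (h.angles.regular s hs k hk)).ne'

theorem mem_tsupport {x : E n} (hx : 0 < p x) : x ∈ tsupport p :=
  subset_tsupport p (Function.mem_support.2 hx.ne')

theorem hasDerivWithinAt_curve (h : IsAdmissible p Γ ℓ ζ) {s : ℝ} (hs : s ∈ Icc 0 ℓ) :
    HasDerivWithinAt Γ (sphericalTangent (ζ s)) (Icc 0 ℓ) s := by
  rw [← h.angles.tangent s hs]
  exact (h.curve.smooth.differentiableOn (by simp) s hs).hasDerivWithinAt

theorem hasDerivAt_curve (h : IsAdmissible p Γ ℓ ζ) {s : ℝ} (hs : s ∈ Ioo 0 ℓ) :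
    HasDerivAt Γ (sphericalTangent (ζ s)) s :=
  (h.hasDerivWithinAt_curve (Ioo_subset_Icc_self hs)).hasDerivAt (Icc_mem_nhds hs.1 hs.2)

theorem hasDerivWithinAt_angles (h : IsAdmissible p Γ ℓ ζ) {s : ℝ} (hs : s ∈ Icc 0 ℓ) :
    HasDerivWithinAt ζ (derivWithin ζ (Icc 0 ℓ) s) (Icc 0 ℓ) s :=
  (h.angles.smooth.differentiableOn (by simp) s hs).hasDerivWithinAt

theorem hasDerivAt_angles (h : IsAdmissible p Γ ℓ ζ) {s : ℝ} (hs : s ∈ Ioo 0 ℓ) :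
    HasDerivAt ζ (derivWithin ζ (Icc 0 ℓ) s) s :=
  (h.hasDerivWithinAt_angles (Ioo_subset_Icc_self hs)).hasDerivAt (Icc_mem_nhds hs.1 hs.2)

theorem hasDerivAt_tangent (h : IsAdmissible p Γ ℓ ζ) {s : ℝ} (hs : s ∈ Ioo 0 ℓ) :
    HasDerivAt (fun t => sphericalTangent (ζ t))
      (∑ j, derivWithin ζ (Icc 0 ℓ) s j • sphericalPartial (ζ s) j) s := by
  rw [← hasDerivWithinAt_univ]
  exact hasDerivWithinAt_sphericalTangent_comp (h.hasDerivAt_angles hs).hasDerivWithinAt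

theorem hasDerivAt_tangentialDefect (h : IsAdmissible p Γ ℓ ζ) (x : E n) {s : ℝ}
    (hs : s ∈ Ioo 0 ℓ) :
    HasDerivAt (tangentialDefect Γ ζ x) (defectSlope Γ ℓ ζ x s) s := by
  have := ((h.hasDerivAt_curve hs).const_sub x).inner ℝ (h.hasDerivAt_tangent hs)
  refine HasDerivAt.congr_deriv this ?_
  simp only [defectSlope, inner_neg_left, inner_sphericalTangent_self, inner_sum,
    real_inner_smul_right]
  ring

theorem hasDerivAt_normSq (h : IsAdmissible p Γ ℓ ζ) (x : E n) {s : ℝ} (hs : s ∈ Ioo 0 ℓ) :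
    HasDerivAt (fun t => ‖x - Γ t‖ ^ 2) (-2 * tangentialDefect Γ ζ x s) s := by
  have := ((h.hasDerivAt_curve hs).const_sub x).norm_sq
  refine HasDerivAt.congr_deriv this ?_
  simp only [tangentialDefect, inner_neg_right]
  ring

theorem isLocalMin_normSq {x : E n} {s : ℝ} (hs : s ∈ Ioo 0 ℓ)
    (hx : s ∈ nearestParams Γ ℓ x) : IsLocalMin (fun t => ‖x - Γ t‖ ^ 2) s := by
  filter_upwards [Icc_mem_nhds hs.1 hs.2] with t ht
  have := (mem_nearestParams_iff.1 hx).2 t ht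
  rw [dist_eq_norm, dist_eq_norm] at this
  exact pow_le_pow_left₀ (norm_nonneg _) this 2

theorem tangentialDefect_eq_zero (h : IsAdmissible p Γ ℓ ζ) {x : E n} {s : ℝ} (hs : s ∈ Ioo 0 ℓ)
    (hx : s ∈ nearestParams Γ ℓ x) : tangentialDefect Γ ζ x s = 0 := by
  have := (isLocalMin_normSq hs hx).hasDerivAt_eq_zero (h.hasDerivAt_normSq x hs)
  linarith

/-- The second derivative of `‖x - Γ t‖²` is `-2` times the slope. A positive slope would make the
minimum also a local maximum, so the function would be locally constant, with zero second
derivative. -/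
theorem defectSlope_nonpos (h : IsAdmissible p Γ ℓ ζ) {x : E n} {s : ℝ} (hs : s ∈ Ioo 0 ℓ)
    (hx : s ∈ nearestParams Γ ℓ x) : defectSlope Γ ℓ ζ x s ≤ 0 := by
  by_contra! hpos
  have hmin := isLocalMin_normSq hs hx
  have hd : deriv (fun t => ‖x - Γ t‖ ^ 2) =ᶠ[𝓝 s] fun t => -2 * tangentialDefect Γ ζ x t := by
    filter_upwards [Ioo_mem_nhds hs.1 hs.2] with t ht using (h.hasDerivAt_normSq x ht).deriv
  have hdd : deriv (deriv fun t => ‖x - Γ t‖ ^ 2) s = -2 * defectSlope Γ ℓ ζ x s := by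
    rw [hd.deriv_eq]
    exact ((h.hasDerivAt_tangentialDefect x hs).const_mul _).deriv
  have hmax := isLocalMax_of_deriv_deriv_neg (by rw [hdd]; linarith)
    (by rw [hd.eq_of_nhds, h.tangentialDefect_eq_zero hs hx, mul_zero])
    (h.hasDerivAt_normSq x hs).continuousAt
  have hconst : (fun t => ‖x - Γ t‖ ^ 2) =ᶠ[𝓝 s] fun _ => ‖x - Γ s‖ ^ 2 := by
    filter_upwards [hmin, hmax] with t h1 h2 using le_antisymm h2 h1
  have h0 := hconst.deriv.deriv_eq
  rw [hdd] at h0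
  simp at h0
  exact hpos.ne' h0

theorem normalMap_sub_curve (q : ℝ × (Fin n → ℝ)) :
    normalMap Γ ζ q - Γ q.1 = ∑ i, q.2 i • frameNormal (ζ q.1) i := by
  simp [normalMap]

theorem tangentialDefect_normalMap (q : ℝ × (Fin n → ℝ)) :
    tangentialDefect Γ ζ (normalMap Γ ζ q) q.1 = 0 := by
  rw [tangentialDefect, normalMap_sub_curve, inner_sum_frameNormal_tangent]

theorem defectSlope_normalMap (q : ℝ × (Fin n → ℝ)) :
    defectSlope Γ ℓ ζ (normalMap Γ ζ q) q.1 = -(1 - ∑ j, q.2 j * curvature ℓ ζ q.1 j) := by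
  rw [defectSlope, normalMap_sub_curve]
  simp only [sum_inner, real_inner_smul_left, inner_frameNormal_sphericalPartial, curvature]
  simp only [mul_ite, mul_zero, Finset.sum_ite_eq', Finset.mem_univ, if_true]
  rw [neg_sub, sub_eq_add_neg, add_comm]
  congr 1
  exact Finset.sum_congr rfl fun j _ => by ring

/-- The inversion `ν (μ x) = x` gives orthogonality even when the projection is an endpoint, where
minimality alone would give only an inequality. -/
theorem tangentialDefect_projIndex (h : IsAdmissible p Γ ℓ ζ) {x : E n} (hx : x ∈ tsupport p)
    (hA : x ∉ ambiguityPoints Γ ℓ) : tangentialDefect Γ ζ x (projIndex Γ ℓ x) = 0 := by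
  have := tangentialDefect_normalMap (Γ := Γ) (ζ := ζ) (normalCoords Γ ℓ ζ x)
  rwa [h.diffeo.leftInv x ⟨hx, hA⟩] at this

/-- Displace `x` by `-εσT` with `ε > 0` small. By `hV` this favours `Γ s` over all nearby curve
points, and far ones are excluded by semicontinuity, so `s` stays the unique closest parameter. The
new residual has tangential component `-εσ ≠ 0`, although it must be orthogonal to `T`. -/
theorem exists_tangent_displacement_false (h : IsAdmissible p Γ ℓ ζ) {x : E n} (hp : 0 < p x)
    (hA : x ∉ ambiguityPoints Γ ℓ) {σ : ℝ} (hσ : σ ≠ 0)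
    (hV : ∀ᶠ t in 𝓝 (projIndex Γ ℓ x), t ∈ Icc 0 ℓ → t ≠ projIndex Γ ℓ x →
      0 < σ * inner ℝ (sphericalTangent (ζ (projIndex Γ ℓ x))) (Γ t - Γ (projIndex Γ ℓ x))) :
    False := by
  have hc := h.curve.smooth.continuousOn
  have hnear := projIndex_mem h.curve.length_pos hc x
  have hdef := h.tangentialDefect_projIndex (mem_tsupport hp) hA
  have huniq := fun t ht => eq_of_notMem_ambiguityPoints h.curve.injOn hA
    (s := t) ht hnear
  set s := projIndex Γ ℓ x
  set T := sphericalTangent (ζ s) with hT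
  obtain ⟨V, hVs, hVo, hsV⟩ := eventually_nhds_iff.1 hV
  have hsub : nearestParams Γ ℓ x ⊆ V := fun t ht => huniq t ht ▸ hsV
  have hcont : Tendsto (fun ε : ℝ => x - (ε * σ) • T) (𝓝[>] 0) (𝓝 x) := by
    have : Continuous fun ε : ℝ => x - (ε * σ) • T := by fun_prop
    have := this.tendsto 0
    simp only [zero_mul, zero_smul, sub_zero] at this
    exact this.mono_left nhdsWithin_le_nhds
  obtain ⟨ε, ⟨h1, h2⟩, hε⟩ := ((hcont.eventually
    ((eventually_nearestParams_subset hc hVo hsub).and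
    (h.continuous.continuousAt.eventually (lt_mem_nhds hp)))).and
    self_mem_nhdsWithin).exists
  set y := x - (ε * σ) • T with hy
  have huy : ∀ t ∈ nearestParams Γ ℓ y, t = s := by
    intro t ht
    by_contra hts
    have hpos := hVs t (h1 ht) ht.1 hts
    have a1 := pow_le_pow_left₀ dist_nonneg ((mem_nearestParams_iff.1 ht).2 s hnear.1) 2
    have a2 := pow_le_pow_left₀ dist_nonneg ((mem_nearestParams_iff.1 hnear).2 t ht.1) 2
    have key : ∀ r, dist y (Γ r) ^ 2 = dist x (Γ r) ^ 2 - 2 * (ε * σ) * inner ℝ T (x - Γ r)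
        + ‖(ε * σ) • T‖ ^ 2 := by
      intro r
      have e : y - Γ r = (x - Γ r) - (ε * σ) • T := by rw [hy]; abel
      rw [dist_eq_norm, dist_eq_norm, e, norm_sub_sq_real, real_inner_smul_right, real_inner_comm]
      ring
    have e2 : inner ℝ T (x - Γ t) = - inner ℝ T (Γ t - Γ s) := by
      have : inner ℝ T (x - Γ s) = 0 := by rw [real_inner_comm]; exact hdef
      rw [← inner_neg_right, ← sub_zero (inner ℝ T (x - Γ t)), ← this, ← inner_sub_right]
      congr 1; abel
    have e3 : inner ℝ T (x - Γ s) = 0 := by rw [real_inner_comm]; exact hdef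
    rw [key, key, e2, e3] at a1
    nlinarith [mul_pos hε hpos]
  have hyn := projIndex_mem h.curve.length_pos hc y
  have hys := huy _ hyn
  obtain ⟨-, hyA⟩ := projIndex_eq_of_unique (hys ▸ hyn) huy
  have hdy := h.tangentialDefect_projIndex (mem_tsupport h2) hyA
  rw [hys, tangentialDefect] at hdy
  have e : y - Γ s = (x - Γ s) - (ε * σ) • T := by rw [hy]; abel
  rw [e, inner_sub_left, real_inner_smul_left, inner_sphericalTangent_self] at hdy
  rw [tangentialDefect] at hdef
  rw [hdef] at hdy
  have := mul_ne_zero hε.ne' hσ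
  apply this
  linarith

theorem projIndex_mem_Ioo (h : IsAdmissible p Γ ℓ ζ) {x : E n} (hp : 0 < p x)
    (hA : x ∉ ambiguityPoints Γ ℓ) : projIndex Γ ℓ x ∈ Ioo 0 ℓ := by
  have hs := (projIndex_mem h.curve.length_pos h.curve.smooth.continuousOn x).1
  -- The function `t ↦ ⟨T, Γ t⟩` has derivative `1` at the projection, so its increments have the
  -- sign of `t - s`. At an endpoint this sign is constant, which selects `σ = 1` or `σ = -1`.
  have hev : ∀ᶠ t in 𝓝 (projIndex Γ ℓ x), t ∈ Icc 0 ℓ → t ≠ projIndex Γ ℓ x →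
      0 < inner ℝ (sphericalTangent (ζ (projIndex Γ ℓ x))) (Γ t - Γ (projIndex Γ ℓ x))
        * (t - projIndex Γ ℓ x) := by
    set s := projIndex Γ ℓ x
    have hd := (innerSL ℝ (sphericalTangent (ζ s))).hasFDerivAt.comp_hasDerivWithinAt s
      (h.hasDerivWithinAt_curve hs)
    rw [hasDerivWithinAt_iff_tendsto_slope] at hd
    have hd1 : (0 : ℝ) < innerSL ℝ (sphericalTangent (ζ s)) (sphericalTangent (ζ s)) := by
      rw [innerSL_apply_apply, inner_sphericalTangent_self]; exact one_pos
    have := hd.eventually (lt_mem_nhds hd1)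
    rw [eventually_nhdsWithin_iff] at this
    filter_upwards [this] with t ht h1 h2
    have h3 := ht ⟨h1, h2⟩
    have h4 : t - s ≠ 0 := sub_ne_zero.2 h2
    simp only [slope, Function.comp, vsub_eq_sub, smul_eq_mul,
      innerSL_apply_apply, ← inner_sub_right] at h3
    have h5 := mul_pos h3 (sq_pos_of_ne_zero h4)
    have h6 : ∀ a b : ℝ, a ≠ 0 → a⁻¹ * b * a ^ 2 = b * a := fun a b ha => by field_simp
    rwa [h6 _ _ h4] at h5
  refine ⟨lt_of_le_of_ne hs.1 fun e => ?_, lt_of_le_of_ne hs.2 fun e => ?_⟩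
  · refine h.exists_tangent_displacement_false hp hA one_ne_zero ?_
    filter_upwards [hev] with t ht h1 h2
    have h3 : 0 < t - projIndex Γ ℓ x :=
      sub_pos.2 (lt_of_le_of_ne (e ▸ h1.1) (Ne.symm h2))
    rw [one_mul]
    exact pos_of_mul_pos_left (ht h1 h2) h3.le
  · refine h.exists_tangent_displacement_false hp hA (σ := -1) (by norm_num) ?_
    filter_upwards [hev] with t ht h1 h2
    have h3 : t - projIndex Γ ℓ x < 0 := sub_neg.2 (lt_of_le_of_ne (e.symm ▸ h1.2) h2)
    nlinarith [ht h1 h2]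

theorem continuousAt_defectSlope (h : IsAdmissible p Γ ℓ ζ) (x : E n) {s : ℝ} (hs : s ∈ Ioo 0 ℓ) :
    ContinuousAt (fun z : E n × ℝ => defectSlope Γ ℓ ζ z.1 z.2) (x, s) := by
  have hd : ContinuousAt (derivWithin ζ (Icc 0 ℓ)) s :=
    (h.angles.smooth.continuousOn_derivWithin (uniqueDiffOn_Icc h.curve.length_pos)
      (by simp)).continuousAt (Icc_mem_nhds hs.1 hs.2)
  have hζ := (h.hasDerivAt_angles hs).continuousAt
  have hΓ := (h.hasDerivAt_curve hs).continuousAt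
  have snd : ContinuousAt (fun z : E n × ℝ => z.2) (x, s) := continuousAt_snd
  unfold defectSlope
  refine continuousAt_const.add (tendsto_finsetSum _ fun j _ => ?_)
  refine ContinuousAt.mul ?_ (Filter.Tendsto.inner (continuousAt_fst.sub ?_) ?_)
  · exact ContinuousAt.comp (g := fun t => derivWithin ζ (Icc 0 ℓ) t j) (x := ((x, s) : E n × ℝ))
      (tendsto_pi_nhds.1 hd j) snd
  · exact ContinuousAt.comp (x := ((x, s) : E n × ℝ)) hΓ snd
  · exact (contDiff_sphericalPartial j).continuous.continuousAt.comp
      (ContinuousAt.comp (x := ((x, s) : E n × ℝ)) hζ snd)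

/-- Differentiating `⟨x - Γ(λ x), T(ζ(λ x))⟩ = 0` in the direction `T` gives `1 + slope · dλ(T) =
0`. -/
theorem defectSlope_ne_zero (h : IsAdmissible p Γ ℓ ζ) {x : E n} (hp : 0 < p x)
    (hA : x ∉ ambiguityPoints Γ ℓ) : defectSlope Γ ℓ ζ x (projIndex Γ ℓ x) ≠ 0 := by
  intro h0
  have hs := h.projIndex_mem_Ioo hp hA
  set S : Set (E n) := tsupport p \ ambiguityPoints Γ ℓ with hS
  have hxS : x ∈ S := ⟨mem_tsupport hp, hA⟩
  obtain ⟨L, hL⟩ : ∃ L, HasFDerivWithinAt (projIndex Γ ℓ) L S x :=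
    ⟨_, ((h.diffeo.differentiable_coords x hxS).fst).hasFDerivWithinAt⟩
  -- The set `S` need not be open, but near `x` it contains a dense part of the open set `{0 < p}`,
  -- which suffices for unique derivatives.
  have hu : UniqueDiffWithinAt ℝ S x := by
    have ho : IsOpen {y | 0 < p y} := isOpen_lt continuous_const h.continuous
    have h1 : UniqueDiffWithinAt ℝ ({y | 0 < p y} ∩ (ambiguityPoints Γ ℓ)ᶜ) x := by
      rw [← uniqueDiffWithinAt_closure, inter_comm]
      exact (ho.uniqueDiffWithinAt hp).mono ((dense_compl_ambiguityPoints h.curve.length_pos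
        h.curve.smooth.continuousOn h.curve.injOn).open_subset_closure_inter ho |>.trans
        (by rw [inter_comm]))
    exact h1.mono fun y hy => ⟨mem_tsupport hy.1, hy.2⟩
  have hd1 := (h.hasDerivAt_curve hs).hasFDerivAt.comp_hasFDerivWithinAt x hL
  have hd2 := (h.hasDerivAt_tangent hs).hasFDerivAt.comp_hasFDerivWithinAt x hL
  have hd3 := ((hasFDerivWithinAt_id x S).sub hd1).inner ℝ hd2
  have hd4 : HasFDerivWithinAt (fun _ : E n => (0 : ℝ)) (0 : E n →L[ℝ] ℝ) S x :=
    hasFDerivWithinAt_const _ _ _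
  have hd5 := hu.eq (hd4.congr (fun y hy => ?_) ?_) hd3
  · have := congrArg (fun M => M (sphericalTangent (ζ (projIndex Γ ℓ x)))) hd5
    rw [defectSlope] at h0
    simp [fderivInnerCLM_apply, inner_sum, real_inner_smul_right, inner_sub_left,
      real_inner_smul_left, norm_sphericalTangent] at this h0
    simp only [mul_sub, Finset.sum_sub_distrib] at h0
    exact zero_ne_one (by
      linear_combination this + L (sphericalTangent (ζ (projIndex Γ ℓ x))) * h0)
  · exact h.tangentialDefect_projIndex hy.1 hy.2
  · exact h.tangentialDefect_projIndex hxS.1 hxS.2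

theorem contDiffAt_normalMap (h : IsAdmissible p Γ ℓ ζ) {q : ℝ × (Fin n → ℝ)}
    (hq : q.1 ∈ Ioo 0 ℓ) : ContDiffAt ℝ ∞ (normalMap Γ ζ) q := by
  have hI := Icc_mem_nhds hq.1 hq.2
  have hζ := (h.angles.smooth.contDiffAt hI).comp q contDiffAt_fst
  refine ((h.curve.smooth.contDiffAt hI).comp q contDiffAt_fst).add
    (ContDiffAt.sum fun i _ => ?_)
  refine ((contDiff_apply ℝ ℝ i).contDiffAt.comp q contDiffAt_snd).smul ?_
  exact ContDiffAt.comp (g := fun θ => frameNormal θ i) q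
    (contDiffAt_frameNormal (h.regular (Ioo_subset_Icc_self hq)) i) hζ

/-- For `r` near `q` the closest parameters of `ν r` stay near `q.1`, where the defect is strictly
decreasing because its slope is negative. The defect vanishes at each of them and also at `r.1`, so
`r.1` is the only one. -/
theorem isOpen_normalDomain (h : IsAdmissible p Γ ℓ ζ) : IsOpen (normalDomain p Γ ℓ ζ) := by
  have hc := h.curve.smooth.continuousOn
  rw [isOpen_iff_mem_nhds]
  rintro q ⟨hq, ⟨hqs, hqA⟩, hqp⟩
  have hνc := (h.contDiffAt_normalMap hq).continuousAt
  have hneg : defectSlope Γ ℓ ζ (normalMap Γ ζ q) q.1 < 0 := by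
    have hn := projIndex_mem h.curve.length_pos hc (normalMap Γ ζ q)
    have h1 := h.defectSlope_ne_zero hqp hqA
    change projIndex Γ ℓ (normalMap Γ ζ q) = q.1 at hqs
    rw [hqs] at hn h1
    exact lt_of_le_of_ne (h.defectSlope_nonpos hq hn) h1
  have hev := (h.continuousAt_defectSlope _ hq).eventually (gt_mem_nhds hneg)
  obtain ⟨W, hW, V, hV, hWV⟩ := mem_nhds_prod_iff.1 hev
  obtain ⟨ε, hε, hball⟩ := Metric.mem_nhds_iff.1 (inter_mem hV (Ioo_mem_nhds hq.1 hq.2))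
  have hsub : nearestParams Γ ℓ (normalMap Γ ζ q) ⊆ Metric.ball q.1 ε := by
    intro t ht
    have hn := projIndex_mem h.curve.length_pos hc (normalMap Γ ζ q)
    rw [eq_of_notMem_ambiguityPoints h.curve.injOn hqA ht hn]
    change projIndex Γ ℓ (normalMap Γ ζ q) = q.1 at hqs
    rw [hqs]
    exact Metric.mem_ball_self hε
  filter_upwards [hνc.eventually (eventually_nearestParams_subset hc Metric.isOpen_ball hsub),
    hνc.eventually hW, hνc.eventually (h.continuous.continuousAt.eventually (lt_mem_nhds hqp)),
    continuousAt_fst.eventually (Metric.ball_mem_nhds q.1 hε)] with r hr1 hr2 hr3 hr4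
  have hanti : StrictAntiOn (tangentialDefect Γ ζ (normalMap Γ ζ r)) (Metric.ball q.1 ε) := by
    refine strictAntiOn_of_deriv_neg (convex_ball _ _) (fun t ht =>
      (h.hasDerivAt_tangentialDefect _ (hball ht).2).continuousAt.continuousWithinAt) fun t ht => ?_
    rw [Metric.isOpen_ball.interior_eq] at ht
    rw [(h.hasDerivAt_tangentialDefect _ (hball ht).2).deriv]
    exact hWV (mk_mem_prod hr2 (hball ht).1)
  have huniq : ∀ t ∈ nearestParams Γ ℓ (normalMap Γ ζ r), t = r.1 := fun t ht =>
    hanti.injOn (hr1 ht) hr4 (by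
      rw [tangentialDefect_normalMap, h.tangentialDefect_eq_zero (hball (hr1 ht)).2 ht])
  have hn := projIndex_mem h.curve.length_pos hc (normalMap Γ ζ r)
  have hmem : r.1 ∈ nearestParams Γ ℓ (normalMap Γ ζ r) := by
    have := huniq _ hn
    rwa [this] at hn
  exact ⟨(hball hr4).2, projIndex_eq_of_unique hmem huniq, hr3⟩

end IsAdmissible

/-! ### Slices of the density and their moments. -/

/-- The normal coordinates of the points for which `Γ s` is a closest point of the curve. -/
def normalCell {n : ℕ} (Γ : ℝ → E n) (ℓ : ℝ) (ζ : ℝ → Fin n → ℝ) (s : ℝ) : Set (Fin n → ℝ) :=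
  {u | s ∈ nearestParams Γ ℓ (normalMap Γ ζ (s, u))}

/-- The density in normal coordinates, without the Jacobian. -/
def sliceDensity {n : ℕ} (p : E n → ℝ) (Γ : ℝ → E n) (ℓ : ℝ) (ζ : ℝ → Fin n → ℝ) :
    ℝ × (Fin n → ℝ) → ℝ :=
  (normalDomain p Γ ℓ ζ).indicator fun q => p (normalMap Γ ζ q)

namespace IsAdmissible

variable {n : ℕ} {p : E n → ℝ} {Γ : ℝ → E n} {ℓ : ℝ} {ζ : ℝ → Fin n → ℝ}

/-- Expanding squared distances makes "not farther than `Γ t`" linear in `u`. The cell is thus an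
intersection of closed half-spaces. -/
theorem normalCell_eq_iInter {s : ℝ} (hs : s ∈ Icc 0 ℓ) :
    normalCell Γ ℓ ζ s = ⋂ t ∈ Icc 0 ℓ, {u : Fin n → ℝ |
      ∑ i, u i * inner ℝ (frameNormal (ζ s) i) (Γ t - Γ s) ≤ ‖Γ t - Γ s‖ ^ 2 / 2} := by
  ext u
  simp only [normalCell, mem_ofPred_eq, mem_nearestParams_iff, mem_iInter, hs, true_and]
  refine forall₂_congr fun t _ => ?_
  have e : normalMap Γ ζ (s, u) - Γ t = (normalMap Γ ζ (s, u) - Γ s) - (Γ t - Γ s) := by abel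
  rw [← sq_le_sq₀ dist_nonneg dist_nonneg, dist_eq_norm, dist_eq_norm, e,
    norm_sub_sq_real (normalMap Γ ζ (s, u) - Γ s), normalMap_sub_curve]
  simp only [sum_inner, real_inner_smul_left]
  constructor <;> intro h <;> linarith

theorem isClosed_normalCell {s : ℝ} (hs : s ∈ Icc 0 ℓ) : IsClosed (normalCell Γ ℓ ζ s) := by
  rw [normalCell_eq_iInter hs]
  exact isClosed_biInter fun t _ => isClosed_le (by fun_prop) continuous_const

theorem convex_normalCell {s : ℝ} (hs : s ∈ Icc 0 ℓ) : Convex ℝ (normalCell Γ ℓ ζ s) := by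
  rw [normalCell_eq_iInter hs]
  refine convex_iInter₂ fun t _ => convex_halfSpace_le ⟨fun u v => ?_, fun c u => ?_⟩ _
  · simp [add_mul, Finset.sum_add_distrib]
  · simp [mul_assoc, Finset.mul_sum]

theorem crossSection_subset_normalCell (h : IsAdmissible p Γ ℓ ζ) (s : ℝ) :
    crossSection Γ ℓ ζ s ⊆ normalCell Γ ℓ ζ s := by
  rintro u ⟨h1, -⟩
  have := projIndex_mem h.curve.length_pos h.curve.smooth.continuousOn (normalMap Γ ζ (s, u))
  rwa [h1] at this

/-- For an interior `u` some `r • u` with `r > 1` is still in the cell, and `u` arises from it by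
shrinking towards `Γ s`, which makes the closest point unique. -/
theorem interior_normalCell_subset (h : IsAdmissible p Γ ℓ ζ) (s : ℝ) :
    interior (normalCell Γ ℓ ζ s) ⊆ crossSection Γ ℓ ζ s := by
  intro u hu
  have hc : Tendsto (fun r : ℝ => r • u) (𝓝[>] 1) (𝓝 u) := by
    have : Continuous fun r : ℝ => r • u := by fun_prop
    have := this.tendsto 1
    rw [one_smul] at this
    exact this.mono_left nhdsWithin_le_nhds
  obtain ⟨r, hr, hr1⟩ :=
    ((hc.eventually (mem_interior_iff_mem_nhds.1 hu)).and self_mem_nhdsWithin).exists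
  replace hr1 : 1 < r := hr1
  have hr0 : r ≠ 0 := by positivity
  have := nearest_of_shrink h.curve.injOn hr (r := r⁻¹) (by positivity) (inv_lt_one_of_one_lt₀ hr1)
  have e : Γ s + r⁻¹ • (normalMap Γ ζ (s, r • u) - Γ s) = normalMap Γ ζ (s, u) := by
    rw [normalMap_sub_curve, normalMap]
    simp [Finset.smul_sum, smul_smul, hr0]
  rw [e] at this
  exact this

theorem ae_mem_crossSection_of_mem_normalCell (h : IsAdmissible p Γ ℓ ζ) {s : ℝ}
    (hs : s ∈ Icc 0 ℓ) :
    ∀ᵐ u : Fin n → ℝ, u ∈ normalCell Γ ℓ ζ s → u ∈ crossSection Γ ℓ ζ s := by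
  have := (convex_normalCell (Γ := Γ) (ζ := ζ) hs).addHaar_frontier (volume : Measure (Fin n → ℝ))
  filter_upwards [measure_eq_zero_iff_ae_notMem.1 this] with u hu hc
  refine h.interior_normalCell_subset s ?_
  by_contra hi
  exact hu ⟨subset_closure hc, hi⟩

theorem crossSection_ae_eq (h : IsAdmissible p Γ ℓ ζ) {s : ℝ} (hs : s ∈ Icc 0 ℓ) :
    crossSection Γ ℓ ζ s =ᵐ[volume] normalCell Γ ℓ ζ s := by
  filter_upwards [h.ae_mem_crossSection_of_mem_normalCell hs] with u hu
  exact propext ⟨fun hu' => h.crossSection_subset_normalCell s hu', hu⟩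

theorem mem_normalDomain (h : IsAdmissible p Γ ℓ ζ) {s : ℝ} {u : Fin n → ℝ}
    (hu : u ∈ crossSection Γ ℓ ζ s) (hp : 0 < p (normalMap Γ ζ (s, u))) :
    (s, u) ∈ normalDomain p Γ ℓ ζ := by
  have := h.projIndex_mem_Ioo hp hu.2
  rw [hu.1] at this
  exact ⟨this, hu, hp⟩

/-- `R(s)` is traded for the closed cell, which differs from it by a null set and is visibly
measurable. -/
theorem setIntegral_crossSection (h : IsAdmissible p Γ ℓ ζ) {s : ℝ} (hs : s ∈ Icc 0 ℓ)
    (f : (Fin n → ℝ) → ℝ) :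
    ∫ u in crossSection Γ ℓ ζ s, f u * p (normalMap Γ ζ (s, u)) =
      ∫ u, f u * sliceDensity p Γ ℓ ζ (s, u) := by
  rw [setIntegral_congr_set (h.crossSection_ae_eq hs),
    ← integral_indicator (isClosed_normalCell hs).measurableSet]
  refine integral_congr_ae ?_
  filter_upwards [h.ae_mem_crossSection_of_mem_normalCell hs] with u hu
  by_cases hc : u ∈ normalCell Γ ℓ ζ s
  · rw [indicator_of_mem hc]
    rcases (h.nonneg (normalMap Γ ζ (s, u))).eq_or_lt with h0 | h0
    · have : (s, u) ∉ normalDomain p Γ ℓ ζ := fun hn => hn.2.2.ne h0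
      simp [sliceDensity, this, ← h0]
    · simp [sliceDensity, h.mem_normalDomain (hu hc) h0]
  · have : (s, u) ∉ normalDomain p Γ ℓ ζ := fun hn =>
      hc (h.crossSection_subset_normalCell s hn.2.1)
    simp [sliceDensity, this, hc]

theorem sliceDensity_nonneg (h : IsAdmissible p Γ ℓ ζ) (q : ℝ × (Fin n → ℝ)) :
    0 ≤ sliceDensity p Γ ℓ ζ q :=
  indicator_nonneg (fun _ _ => h.nonneg _) _

theorem sliceDensity_le (h : IsAdmissible p Γ ℓ ζ) (q : ℝ × (Fin n → ℝ)) :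
    sliceDensity p Γ ℓ ζ q ≤ p (normalMap Γ ζ q) :=
  indicator_le_self' (fun _ _ => h.nonneg _) _

theorem sliceDensity_pos_iff {q : ℝ × (Fin n → ℝ)} :
    0 < sliceDensity p Γ ℓ ζ q ↔ q ∈ normalDomain p Γ ℓ ζ := by
  constructor
  · intro hq
    by_contra hn
    simp [sliceDensity, hn] at hq
  · intro hq
    simpa [sliceDensity, hq] using hq.2.2

theorem exists_bound (h : IsAdmissible p Γ ℓ ζ) :
    ∃ B M : ℝ, ∀ q, sliceDensity p Γ ℓ ζ q ≤ M ∧ (B < ‖q.2‖ → sliceDensity p Γ ℓ ζ q = 0) := by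
  obtain ⟨M, hM⟩ := h.continuous.bounded_above_of_compact_support h.compact
  obtain ⟨B₁, hB₁⟩ := h.compact.isBounded.exists_norm_le
  obtain ⟨B₂, hB₂⟩ := (isCompact_Icc.image_of_continuousOn
    h.curve.smooth.continuousOn).isBounded.exists_norm_le
  refine ⟨B₁ + B₂, M, fun q => ⟨(h.sliceDensity_le q).trans
    ((le_abs_self _).trans (hM _)), fun hq => ?_⟩⟩
  by_contra h0
  have hmem := sliceDensity_pos_iff.1 (lt_of_le_of_ne (h.sliceDensity_nonneg q) (Ne.symm h0))
  have hI := Ioo_subset_Icc_self hmem.1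
  have h1 := norm_le_norm_sum_frameNormal (h.regular hI) q.2
  rw [← normalMap_sub_curve] at h1
  have h2 := (norm_sub_le _ _).trans (add_le_add (hB₁ _ (mem_tsupport hmem.2.2))
    (hB₂ _ (mem_image_of_mem Γ hI)))
  linarith

theorem continuousOn_normalMap (h : IsAdmissible p Γ ℓ ζ) :
    ContinuousOn (normalMap Γ ζ) (normalDomain p Γ ℓ ζ) := fun _ hq =>
  (h.contDiffAt_normalMap hq.1).continuousAt.continuousWithinAt

theorem measurable_sliceDensity (h : IsAdmissible p Γ ℓ ζ) :
    Measurable (sliceDensity p Γ ℓ ζ) := by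
  classical
  have := (h.continuous.comp_continuousOn h.continuousOn_normalMap).measurable_piecewise
    (g := 0) continuousOn_const h.isOpen_normalDomain.measurableSet
  rwa [piecewise_eq_indicator] at this

/-- Only cell points outside `R(s)`, a null set, are discarded. Inside the open domain the density
is `p ∘ ν`; where `p ∘ ν` vanishes, it is squeezed to zero. -/
theorem ae_continuousAt_sliceDensity (h : IsAdmissible p Γ ℓ ζ) {s : ℝ} (hs : s ∈ Ioo 0 ℓ) :
    ∀ᵐ u : Fin n → ℝ, ContinuousAt (fun t => sliceDensity p Γ ℓ ζ (t, u)) s := by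
  filter_upwards [h.ae_mem_crossSection_of_mem_normalCell (Ioo_subset_Icc_self hs)] with u hu
  have hν : ContinuousAt (fun t => normalMap Γ ζ (t, u)) s :=
    ContinuousAt.comp (g := normalMap Γ ζ) (h.contDiffAt_normalMap (q := (s, u)) hs).continuousAt
      (by fun_prop)
  have hpν : ContinuousAt (fun t => p (normalMap Γ ζ (t, u))) s :=
    h.continuous.continuousAt.comp hν
  by_cases hU : (s, u) ∈ normalDomain p Γ ℓ ζ
  · refine hpν.congr ?_
    have hc : ContinuousAt (fun t : ℝ => (t, u)) s := by fun_prop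
    filter_upwards [hc.eventually (h.isOpen_normalDomain.mem_nhds hU)] with t ht
    exact (indicator_of_mem (show (t, u) ∈ normalDomain p Γ ℓ ζ from ht)
      fun q => p (normalMap Γ ζ q)).symm
  have h0 : sliceDensity p Γ ℓ ζ (s, u) = 0 := by simp [sliceDensity, hU]
  rcases (h.nonneg (normalMap Γ ζ (s, u))).eq_or_lt with hp | hp
  · rw [ContinuousAt, h0]
    rw [ContinuousAt, ← hp] at hpν
    exact squeeze_zero (fun t => h.sliceDensity_nonneg _) (fun t => h.sliceDensity_le _) hpν
  -- Some `Γ t` is strictly closer than `Γ s`. This persists for nearby parameters, so the density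
  -- is zero around `s`.
  · have hc : u ∉ normalCell Γ ℓ ζ s := fun hc => hU (h.mem_normalDomain (hu hc) hp)
    have hlt : ∃ t ∈ Icc 0 ℓ,
        dist (normalMap Γ ζ (s, u)) (Γ t) < dist (normalMap Γ ζ (s, u)) (Γ s) := by
      by_contra! hcon
      exact hc (mem_nearestParams_iff.2 ⟨Ioo_subset_Icc_self hs, hcon⟩)
    obtain ⟨t, ht, htlt⟩ := hlt
    have hev := (hν.dist continuousAt_const).eventually_lt
      (hν.dist (h.hasDerivAt_curve hs).continuousAt) htlt
    refine continuousAt_const.congr (f := fun _ => (0 : ℝ)) ?_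
    filter_upwards [hev] with r hr
    refine (indicator_of_notMem (fun hn => ?_) _).symm
    exact absurd hr (not_lt.2
      ((mem_nearestParams_iff.1 (h.crossSection_subset_normalCell r hn.2.1)).2 t ht))

theorem exists_integrable_bound (h : IsAdmissible p Γ ℓ ζ) {f : (Fin n → ℝ) → ℝ}
    (hf : Continuous f) : ∃ g : (Fin n → ℝ) → ℝ, Integrable g ∧
      ∀ s u, ‖f u * sliceDensity p Γ ℓ ζ (s, u)‖ ≤ g u := by
  obtain ⟨B, M, hBM⟩ := h.exists_bound
  refine ⟨(Metric.closedBall 0 B).indicator fun u => ‖f u‖ * M,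
    (integrable_indicator_iff Metric.isClosed_closedBall.measurableSet).2
      ((hf.norm.mul continuous_const).continuousOn.integrableOn_compact
        (isCompact_closedBall 0 B)), fun s u => ?_⟩
  by_cases hu : u ∈ Metric.closedBall 0 B
  · rw [indicator_of_mem hu, norm_mul, Real.norm_of_nonneg (h.sliceDensity_nonneg _)]
    exact mul_le_mul_of_nonneg_left (hBM (s, u)).1 (norm_nonneg _)
  · rw [indicator_of_notMem hu, (hBM (s, u)).2 (by simpa using hu)]
    simp

theorem integrable_mul_sliceDensity (h : IsAdmissible p Γ ℓ ζ) {f : (Fin n → ℝ) → ℝ}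
    (hf : Continuous f) (s : ℝ) : Integrable fun u => f u * sliceDensity p Γ ℓ ζ (s, u) := by
  obtain ⟨g, hg, hle⟩ := h.exists_integrable_bound hf
  exact hg.mono' (hf.measurable.mul (h.measurable_sliceDensity.comp
    measurable_prodMk_left)).aestronglyMeasurable (Eventually.of_forall (hle s))

theorem continuousAt_integral_mul_sliceDensity (h : IsAdmissible p Γ ℓ ζ)
    {f : (Fin n → ℝ) → ℝ} (hf : Continuous f) {s : ℝ} (hs : s ∈ Ioo 0 ℓ) :
    ContinuousAt (fun t => ∫ u, f u * sliceDensity p Γ ℓ ζ (t, u)) s := by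
  obtain ⟨g, hg, hle⟩ := h.exists_integrable_bound hf
  refine continuousAt_of_dominated (Eventually.of_forall fun t =>
    (h.integrable_mul_sliceDensity hf t).aestronglyMeasurable)
    (Eventually.of_forall fun t => Eventually.of_forall (hle t)) hg ?_
  filter_upwards [h.ae_continuousAt_sliceDensity hs] with u hu
  exact continuousAt_const.mul hu

theorem transverseMoment_eq_integral (h : IsAdmissible p Γ ℓ ζ) {s : ℝ} (hs : s ∈ Icc 0 ℓ)
    (j : Fin n → ℕ) : transverseMoment p Γ ℓ ζ j s =
      ∫ u, (∏ i, u i ^ j i) * sliceDensity p Γ ℓ ζ (s, u) :=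
  h.setIntegral_crossSection hs _

theorem transverseMoment_zero (h : IsAdmissible p Γ ℓ ζ) {s : ℝ} (hs : s ∈ Icc 0 ℓ) :
    transverseMoment p Γ ℓ ζ 0 s = ∫ u, sliceDensity p Γ ℓ ζ (s, u) := by
  rw [h.transverseMoment_eq_integral hs]
  simp

theorem transverseMoment_single (h : IsAdmissible p Γ ℓ ζ) {s : ℝ} (hs : s ∈ Icc 0 ℓ)
    (i : Fin n) : transverseMoment p Γ ℓ ζ (Pi.single i 1) s =
      ∫ u, u i * sliceDensity p Γ ℓ ζ (s, u) := by
  rw [h.transverseMoment_eq_integral hs]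
  simp [Pi.single_apply, pow_ite]

theorem transverseMoment_single_add_single (h : IsAdmissible p Γ ℓ ζ) {s : ℝ} (hs : s ∈ Icc 0 ℓ)
    (i j : Fin n) : transverseMoment p Γ ℓ ζ (Pi.single i 1 + Pi.single j 1) s =
      ∫ u, u i * u j * sliceDensity p Γ ℓ ζ (s, u) := by
  rw [h.transverseMoment_eq_integral hs]
  simp only [Pi.add_apply, pow_add, Finset.prod_mul_distrib]
  simp [Pi.single_apply, pow_ite]

theorem isOpen_slice (h : IsAdmissible p Γ ℓ ζ) (s : ℝ) :
    IsOpen {u | (s, u) ∈ normalDomain p Γ ℓ ζ} :=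
  h.isOpen_normalDomain.preimage (by fun_prop)

theorem integral_sliceDensity_pos (h : IsAdmissible p Γ ℓ ζ) {s : ℝ} {u : Fin n → ℝ}
    (hu : (s, u) ∈ normalDomain p Γ ℓ ζ) : 0 < ∫ u, sliceDensity p Γ ℓ ζ (s, u) := by
  have hi : Integrable fun u => sliceDensity p Γ ℓ ζ (s, u) := by
    simpa using h.integrable_mul_sliceDensity (f := fun _ => 1) continuous_const s
  rw [integral_pos_iff_support_of_nonneg (fun u => h.sliceDensity_nonneg _) hi]
  refine lt_of_lt_of_le ((h.isOpen_slice s).measure_pos volume ⟨u, hu⟩)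
    (measure_mono fun v hv => ?_)
  exact (sliceDensity_pos_iff.2 hv).ne'

theorem transverseMoment_zero_pos (h : IsAdmissible p Γ ℓ ζ) {s : ℝ} (hs : s ∈ Icc 0 ℓ)
    (hp : 0 < p (Γ s)) : 0 < transverseMoment p Γ ℓ ζ 0 s := by
  rw [h.transverseMoment_zero hs]
  have e : normalMap Γ ζ (s, 0) = Γ s := by simp [normalMap]
  refine h.integral_sliceDensity_pos (u := 0) (h.mem_normalDomain ?_ (by rwa [e]))
  have := projIndex_eq_of_unique (x := Γ s) (s := s) (Γ := Γ) (ℓ := ℓ)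
    (mem_nearestParams_iff.2 ⟨hs, fun t _ => by simp⟩) fun t ht => by
      have := (mem_nearestParams_iff.1 ht).2 s hs
      rw [dist_self] at this
      exact (h.curve.injOn hs ht.1 (dist_le_zero.1 this)).symm
  exact ⟨by rw [e]; exact this.1, by rw [e]; exact this.2⟩

theorem odeMatrix_apply (p : E n → ℝ) (Γ : ℝ → E n) (ℓ : ℝ) (ζ : ℝ → Fin n → ℝ) (s : ℝ)
    (i j : Fin n) :
    odeMatrix p Γ ℓ ζ s i j = transverseMoment p Γ ℓ ζ (Pi.single i 1 + Pi.single j 1) s /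
        transverseMoment p Γ ℓ ζ 0 s := by
  simp [odeMatrix, transverseCov]

/-- The matrix is the uncentred second-moment matrix. If it kills `c`, then `(c · u)²` has zero
integral against a density positive on a nonempty open set, so `c · u = 0` on that set. -/
theorem isUnit_odeMatrix (h : IsAdmissible p Γ ℓ ζ) {s : ℝ} (hs : s ∈ Icc 0 ℓ)
    (h0 : transverseMoment p Γ ℓ ζ 0 s ≠ 0) : IsUnit (odeMatrix p Γ ℓ ζ s) := by
  rw [← Matrix.mulVec_injective_iff_isUnit]
  refine (injective_iff_map_eq_zero (odeMatrix p Γ ℓ ζ s).mulVecLin).2 fun c hc => ?_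
  replace hc : odeMatrix p Γ ℓ ζ s *ᵥ c = 0 := hc
  have hint : ∫ u, (∑ i, c i * u i) ^ 2 * sliceDensity p Γ ℓ ζ (s, u) = 0 := by
    have h1 : ∀ i, ∑ j, (∫ u, u i * u j * sliceDensity p Γ ℓ ζ (s, u)) * c j = 0 := by
      intro i
      have := congrFun hc i
      simp only [Matrix.mulVec, dotProduct, odeMatrix_apply, div_mul_eq_mul_div,
        ← Finset.sum_div, Pi.zero_apply, div_eq_zero_iff, h0, or_false] at this
      simpa only [h.transverseMoment_single_add_single hs] using this
    have h2 : ∑ i, c i * ∑ j, (∫ u, u i * u j * sliceDensity p Γ ℓ ζ (s, u)) * c j = 0 := by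
      simp [h1]
    rw [← h2]
    simp only [Finset.mul_sum, ← integral_mul_const, ← integral_const_mul]
    have hI : ∀ i j, Integrable fun u : Fin n → ℝ =>
        c i * (u i * u j * sliceDensity p Γ ℓ ζ (s, u) * c j) := fun i j =>
      ((h.integrable_mul_sliceDensity (f := fun u => u i * u j) (by fun_prop) s).mul_const
        (c j)).const_mul (c i)
    simp_rw [← integral_finsetSum _ fun j _ => hI _ j]
    rw [← integral_finsetSum _ fun i _ => integrable_finsetSum _ fun j _ => hI i j]
    congr 1 with u
    rw [sq, Finset.sum_mul_sum, Finset.sum_mul]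
    refine Finset.sum_congr rfl fun i _ => ?_
    rw [Finset.sum_mul]
    exact Finset.sum_congr rfl fun j _ => by ring
  have hae := (integral_eq_zero_iff_of_nonneg (fun u => mul_nonneg (sq_nonneg _)
    (h.sliceDensity_nonneg _)) (h.integrable_mul_sliceDensity
      (f := fun u => (∑ i, c i * u i) ^ 2) (by fun_prop) s)).1 hint
  have hopen : IsOpen ({u | (s, u) ∈ normalDomain p Γ ℓ ζ} ∩ {u | ∑ i, c i * u i ≠ 0}) :=
    (h.isOpen_slice s).inter (isOpen_ne_fun (by fun_prop) continuous_const)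
  have hnull : volume ({u | (s, u) ∈ normalDomain p Γ ℓ ζ} ∩ {u | ∑ i, c i * u i ≠ 0}) = 0 := by
    refine measure_mono_null (fun u hu => ?_) (ae_iff.1 hae)
    intro hu0
    have := mul_pos (sq_pos_of_ne_zero hu.2) (sliceDensity_pos_iff.2 hu.1)
    exact this.ne' hu0
  have hempty := hopen.eq_empty_of_measure_zero hnull
  rw [h.transverseMoment_zero hs] at h0
  obtain ⟨u, hu⟩ : ∃ u, (s, u) ∈ normalDomain p Γ ℓ ζ := by
    by_contra! hcon
    exact h0 (by simp [sliceDensity, hcon])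
  have hzero : ∀ v, (s, v) ∈ normalDomain p Γ ℓ ζ → ∑ i, c i * v i = 0 := by
    intro v hv
    by_contra hne
    exact eq_empty_iff_forall_notMem.1 hempty v ⟨hv, hne⟩
  -- Comparing `u` with `u + ε c` inside the open slice yields `ε (c · c) = 0`.
  have ht : Tendsto (fun ε : ℝ => u + ε • c) (𝓝[>] 0) (𝓝 u) := by
    have : Continuous fun ε : ℝ => u + ε • c := by fun_prop
    have := this.tendsto 0
    rw [zero_smul, add_zero] at this
    exact this.mono_left nhdsWithin_le_nhds
  obtain ⟨ε, hε, hε0⟩ := ((ht.eventually ((h.isOpen_slice s).mem_nhds hu)).and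
    self_mem_nhdsWithin).exists
  have h1 := hzero _ hε
  have h2 := hzero _ hu
  simp only [Pi.add_apply, Pi.smul_apply, smul_eq_mul, mul_add, Finset.sum_add_distrib, h2,
    zero_add] at h1
  have h3 : ε * ∑ i, c i * c i = 0 := by
    rw [← h1, Finset.mul_sum]
    exact Finset.sum_congr rfl fun i _ => by ring
  exact dotProduct_self_eq_zero.1 ((mul_eq_zero.1 h3).resolve_left (ne_of_gt hε0))

end IsAdmissible

/-! ### The Jacobian and the change of variables. -/

theorem abs_det_eq_abs_det_inner {n : ℕ} (b : OrthonormalBasis (Fin (n + 1)) ℝ (E n))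
    (L : E n →ₗ[ℝ] E n) :
    |LinearMap.det L| = |(Matrix.of fun i j =>
      inner ℝ (b i) (L (EuclideanSpace.single j 1))).det| := by
  set e := EuclideanSpace.basisFun (Fin (n + 1)) ℝ
  have h1 : (Matrix.of fun i j => inner ℝ (b i) (L (EuclideanSpace.single j 1)))
      = LinearMap.toMatrix e.toBasis b.toBasis L := by
    ext i j
    simp [LinearMap.toMatrix_apply, e, OrthonormalBasis.repr_apply_apply]
  rw [h1, ← basis_toMatrix_mul_linearMap_toMatrix e.toBasis b.toBasis e.toBasis L, Matrix.det_mul,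
    LinearMap.det_toMatrix, abs_mul]
  have h2 : |(b.toBasis.toMatrix e.toBasis).det| = 1 := by
    have := b.det_to_matrix_orthonormalBasis e
    rw [Module.Basis.det_apply] at this
    simpa using this
  rw [h2, one_mul]

/-- The splitting of `ℝ^(n+1)` into the first coordinate and the others. -/
def splitCoords (n : ℕ) : E n →L[ℝ] ℝ × (Fin n → ℝ) :=
  (EuclideanSpace.proj 0).prod (ContinuousLinearMap.pi fun i => EuclideanSpace.proj i.succ)

/-- The splitting of `ℝ^(n+1)` into the first coordinate and the others, as an isomorphism of
measurable spaces. -/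
def splitCoordsEquiv (n : ℕ) : E n ≃ᵐ ℝ × (Fin n → ℝ) :=
  (MeasurableEquiv.toLp 2 (Fin (n + 1) → ℝ)).symm.trans
    (MeasurableEquiv.piFinSuccAbove (fun _ => ℝ) 0)

theorem coe_splitCoordsEquiv (n : ℕ) : ⇑(splitCoordsEquiv n) = splitCoords n := rfl

theorem measurePreserving_splitCoordsEquiv (n : ℕ) : MeasurePreserving (splitCoordsEquiv n) :=
  (PiLp.volume_preserving_ofLp (Fin (n + 1))).trans
    (volume_preserving_piFinSuccAbove (fun _ => ℝ) 0)

namespace IsAdmissible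

variable {n : ℕ} {p : E n → ℝ} {Γ : ℝ → E n} {ℓ : ℝ} {ζ : ℝ → Fin n → ℝ}

theorem hasFDerivAt_normalMap (h : IsAdmissible p Γ ℓ ζ) {q : ℝ × (Fin n → ℝ)}
    (hq : q.1 ∈ Ioo 0 ℓ) : HasFDerivAt (normalMap Γ ζ) (fderiv ℝ (normalMap Γ ζ) q) q :=
  ((h.contDiffAt_normalMap hq).differentiableAt (by simp)).hasFDerivAt

theorem fderiv_normalMap_single (h : IsAdmissible p Γ ℓ ζ) {q : ℝ × (Fin n → ℝ)}
    (hq : q.1 ∈ Ioo 0 ℓ) (i : Fin n) :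
    fderiv ℝ (normalMap Γ ζ) q (0, Pi.single i 1) = frameNormal (ζ q.1) i := by
  have h1 : HasDerivAt (fun t : ℝ => normalMap Γ ζ (q + t • ((0, Pi.single i 1) : ℝ × (Fin n → ℝ))))
      (fderiv ℝ (normalMap Γ ζ) q (0, Pi.single i 1)) 0 :=
    (h.hasFDerivAt_normalMap hq).hasLineDerivAt _
  have h2 : HasDerivAt (fun t : ℝ => normalMap Γ ζ q + t • frameNormal (ζ q.1) i)
      (frameNormal (ζ q.1) i) 0 := by
    simpa using ((hasDerivAt_id (0 : ℝ)).smul_const (frameNormal (ζ q.1) i)).const_add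
      (normalMap Γ ζ q)
  refine h1.unique (h2.congr_of_eventuallyEq (Eventually.of_forall fun t => ?_))
  simp [normalMap, add_smul, Finset.sum_add_distrib, Pi.single_apply, add_assoc]

/-- Obtained by differentiating the identity `⟨ν(t, u) - Γ t, T(ζ t)⟩ = 0` in `t`, without computing
derivatives of the normals. -/
theorem inner_tangent_fderiv_normalMap (h : IsAdmissible p Γ ℓ ζ) {q : ℝ × (Fin n → ℝ)}
    (hq : q.1 ∈ Ioo 0 ℓ) :
    inner ℝ (sphericalTangent (ζ q.1)) (fderiv ℝ (normalMap Γ ζ) q (1, 0)) =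
      1 - ∑ j, q.2 j * curvature ℓ ζ q.1 j := by
  have h1 : HasDerivAt (fun t : ℝ => normalMap Γ ζ (t, q.2))
      (fderiv ℝ (normalMap Γ ζ) q (1, 0)) q.1 :=
    HasFDerivAt.comp_hasDerivAt (l := normalMap Γ ζ) (f := fun t : ℝ => (t, q.2)) q.1
      (h.hasFDerivAt_normalMap hq) ((hasDerivAt_id q.1).prodMk (hasDerivAt_const q.1 q.2))
  have h2 := (h1.sub (h.hasDerivAt_curve hq)).inner ℝ (h.hasDerivAt_tangent hq)
  have h3 := h2.unique ((hasDerivAt_const q.1 (0 : ℝ)).congr_of_eventuallyEq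
    (Eventually.of_forall fun t => tangentialDefect_normalMap (t, q.2)))
  have h4 := defectSlope_normalMap (Γ := Γ) (ℓ := ℓ) (ζ := ζ) q
  simp only [defectSlope, Pi.sub_apply, inner_sub_left (𝕜 := ℝ) (fderiv ℝ _ q (1, 0)), inner_sum,
    real_inner_smul_right, inner_sphericalTangent_self] at h3 h4
  rw [real_inner_comm]
  linarith

/-- Composing with `splitCoords` gives an endomorphism, which has a determinant. In the frame, the
`u_j`-columns are basis vectors, so the matrix is lower triangular and only the tangential part of
`∂ν/∂s` counts. -/
theorem abs_det_fderiv_normalMap (h : IsAdmissible p Γ ℓ ζ) {q : ℝ × (Fin n → ℝ)}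
    (hq : q.1 ∈ Ioo 0 ℓ) :
    |((fderiv ℝ (normalMap Γ ζ) q).comp (splitCoords n)).det| =
      |1 - ∑ j, q.2 j * curvature ℓ ζ q.1 j| := by
  have hr := h.regular (Ioo_subset_Icc_self hq)
  rw [ContinuousLinearMap.det, abs_det_eq_abs_det_inner (frameBasis hr)]
  have h0 : splitCoords n (EuclideanSpace.single 0 1) = (1, 0) := by
    ext i <;> simp [splitCoords]
  have hs : ∀ j : Fin n, splitCoords n (EuclideanSpace.single j.succ 1) = (0, Pi.single j 1) := by
    intro j
    ext i <;> simp [splitCoords, Pi.single_apply]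
  have hcol : ∀ (i : Fin (n + 1)) (j : Fin n), inner ℝ (frameBasis hr i)
      ((fderiv ℝ (normalMap Γ ζ) q) (splitCoords n (EuclideanSpace.single j.succ 1)))
      = if i = j.succ then 1 else 0 := by
    intro i j
    have : frameNormal (ζ q.1) j = frameBasis hr j.succ := by simp [coe_frameBasis, frame]
    rw [hs, h.fderiv_normalMap_single hq, this]
    exact orthonormal_iff_ite.1 (frameBasis hr).orthonormal i j.succ
  rw [Matrix.det_of_isLowerTriangular, Fin.prod_univ_succ]
  · simp only [Matrix.of_apply, ContinuousLinearMap.coe_coe, ContinuousLinearMap.comp_apply, hcol,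
      if_true, Finset.prod_const_one, mul_one, h0]
    rw [coe_frameBasis, frame, Fin.cons_zero, h.inner_tangent_fderiv_normalMap hq]
  · intro i j hij
    induction j using Fin.cases with
    | zero => exact absurd (show i < 0 from hij) (Fin.not_lt_zero i)
    | succ j =>
      simp only [Matrix.of_apply, ContinuousLinearMap.coe_coe, ContinuousLinearMap.comp_apply, hcol]
      exact if_neg (ne_of_lt (show i < j.succ from hij))

theorem jacobian_nonneg (h : IsAdmissible p Γ ℓ ζ) {q : ℝ × (Fin n → ℝ)}
    (hq : q ∈ normalDomain p Γ ℓ ζ) : 0 ≤ 1 - ∑ j, q.2 j * curvature ℓ ζ q.1 j := by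
  have := h.defectSlope_nonpos hq.1 (h.crossSection_subset_normalCell q.1 hq.2.1)
  rw [defectSlope_normalMap (q := (q.1, q.2))] at this
  linarith

theorem projIndex_normalMap {q : ℝ × (Fin n → ℝ)}
    (hq : q ∈ normalDomain p Γ ℓ ζ) : projIndex Γ ℓ (normalMap Γ ζ q) = q.1 := hq.2.1.1

theorem injOn_normalMap (h : IsAdmissible p Γ ℓ ζ) :
    InjOn (normalMap Γ ζ) (normalDomain p Γ ℓ ζ) := by
  rintro ⟨s, u⟩ hq ⟨s', u'⟩ hq' heq
  have h1 : s = s' := by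
    have := congrArg (projIndex Γ ℓ) heq
    rwa [projIndex_normalMap hq, projIndex_normalMap hq'] at this
  subst h1
  refine Prod.ext rfl (funext fun i => ?_)
  have hr := h.regular (Ioo_subset_Icc_self hq.1)
  have h2 : ∑ i, u i • frameNormal (ζ s) i = ∑ i, u' i • frameNormal (ζ s) i := by
    simpa [normalMap] using heq
  have := congrArg (fun v => inner ℝ v (frameNormal (ζ s) i)) h2
  simpa only [inner_sum_frameNormal hr] using this

theorem image_normalMap (h : IsAdmissible p Γ ℓ ζ) (B : Set ℝ) :
    normalMap Γ ζ '' (normalDomain p Γ ℓ ζ ∩ Prod.fst ⁻¹' B) =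
      projIndex Γ ℓ ⁻¹' B ∩ ({x | 0 < p x} \ ambiguityPoints Γ ℓ) := by
  ext x
  constructor
  · rintro ⟨q, ⟨hq, hB⟩, rfl⟩
    refine ⟨?_, hq.2.2, hq.2.1.2⟩
    rw [mem_preimage, projIndex_normalMap hq]
    exact hB
  · rintro ⟨hB, hp, hA⟩
    have hinv := h.diffeo.leftInv x ⟨mem_tsupport hp, hA⟩
    refine ⟨normalCoords Γ ℓ ζ x, ⟨⟨h.projIndex_mem_Ioo hp hA, ⟨?_, ?_⟩, ?_⟩, hB⟩, hinv⟩
    · change projIndex Γ ℓ (normalMap Γ ζ (normalCoords Γ ℓ ζ x)) = projIndex Γ ℓ x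
      rw [hinv]
    · change normalMap Γ ζ (normalCoords Γ ℓ ζ x) ∉ _
      rwa [hinv]
    · rwa [hinv]

/-- The residual `x - Γ (λ x)` in normal coordinates, weighted by the density and the Jacobian. -/
def weightedResidual (p : E n → ℝ) (Γ : ℝ → E n) (ℓ : ℝ) (ζ : ℝ → Fin n → ℝ)
    (q : ℝ × (Fin n → ℝ)) : E n :=
  ((1 - ∑ j, q.2 j * curvature ℓ ζ q.1 j) * sliceDensity p Γ ℓ ζ q) •
    ∑ i, q.2 i • frameNormal (ζ q.1) i

theorem weightedResidual_of_mem (h : IsAdmissible p Γ ℓ ζ) {q : ℝ × (Fin n → ℝ)}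
    (hq : q ∈ normalDomain p Γ ℓ ζ) :
    |((fderiv ℝ (normalMap Γ ζ) q).comp (splitCoords n)).det| •
      (p (normalMap Γ ζ q) • (normalMap Γ ζ q - Γ (projIndex Γ ℓ (normalMap Γ ζ q)))) =
    weightedResidual p Γ ℓ ζ q := by
  rw [h.abs_det_fderiv_normalMap hq.1, abs_of_nonneg (h.jacobian_nonneg hq),
    projIndex_normalMap hq, normalMap_sub_curve, smul_smul, weightedResidual, sliceDensity,
    indicator_of_mem hq]

theorem weightedResidual_of_notMem {q : ℝ × (Fin n → ℝ)}
    (hq : q ∉ normalDomain p Γ ℓ ζ) : weightedResidual p Γ ℓ ζ q = 0 := by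
  simp [weightedResidual, sliceDensity, hq]

theorem hasFDerivWithinAt_normalMap_splitCoords (h : IsAdmissible p Γ ℓ ζ) (S : Set (E n))
    (x : E n) (hx : splitCoords n x ∈ normalDomain p Γ ℓ ζ) :
    HasFDerivWithinAt (normalMap Γ ζ ∘ splitCoords n)
      ((fderiv ℝ (normalMap Γ ζ) (splitCoords n x)).comp (splitCoords n)) S x :=
  ((h.hasFDerivAt_normalMap hx.1).comp x (splitCoords n).hasFDerivAt).hasFDerivWithinAt

theorem injOn_normalMap_splitCoords (h : IsAdmissible p Γ ℓ ζ) :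
    InjOn (normalMap Γ ζ ∘ splitCoords n) (splitCoords n ⁻¹' normalDomain p Γ ℓ ζ) := by
  refine h.injOn_normalMap.comp ?_ (fun _ hx => hx)
  rw [← coe_splitCoordsEquiv]
  exact (splitCoordsEquiv n).injective.injOn

/-- Points with `p = 0` contribute nothing and ambiguity points are null; the rest is the injective
image of `normalDomain` over `B`. -/
theorem setIntegral_projIndex_preimage (h : IsAdmissible p Γ ℓ ζ) {B : Set ℝ}
    (hB : MeasurableSet B) :
    ∫ x in projIndex Γ ℓ ⁻¹' B, p x • (x - Γ (projIndex Γ ℓ x)) =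
      ∫ q in Prod.fst ⁻¹' B, weightedResidual p Γ ℓ ζ q := by
  have hm : MeasurableSet (normalDomain p Γ ℓ ζ ∩ Prod.fst ⁻¹' B) :=
    h.isOpen_normalDomain.measurableSet.inter (measurable_fst hB)
  have hBm : MeasurableSet (projIndex Γ ℓ ⁻¹' B) :=
    measurable_projIndex h.curve.length_pos h.curve.smooth.continuousOn hB
  have hm' : MeasurableSet (splitCoords n ⁻¹' (normalDomain p Γ ℓ ζ ∩ Prod.fst ⁻¹' B)) :=
    (splitCoords n).continuous.measurable hm
  have himage : (normalMap Γ ζ ∘ splitCoords n) ''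
      (splitCoords n ⁻¹' (normalDomain p Γ ℓ ζ ∩ Prod.fst ⁻¹' B)) =
      projIndex Γ ℓ ⁻¹' B ∩ ({x | 0 < p x} \ ambiguityPoints Γ ℓ) := by
    rw [image_comp, image_preimage_eq _ (coe_splitCoordsEquiv n ▸ (splitCoordsEquiv n).surjective),
      h.image_normalMap]
  have h1 : ∫ x in projIndex Γ ℓ ⁻¹' B, p x • (x - Γ (projIndex Γ ℓ x)) =
      ∫ x in projIndex Γ ℓ ⁻¹' B ∩ ({x | 0 < p x} \ ambiguityPoints Γ ℓ),
        p x • (x - Γ (projIndex Γ ℓ x)) := by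
    have hae : (projIndex Γ ℓ ⁻¹' B ∩ ({x | 0 < p x} \ ambiguityPoints Γ ℓ) : Set (E n)) =ᵐ[volume]
        (projIndex Γ ℓ ⁻¹' B ∩ {x | 0 < p x} : Set (E n)) := by
      filter_upwards [measure_eq_zero_iff_ae_notMem.1
        (volume_ambiguityPoints (Γ := Γ) (ℓ := ℓ))] with x hx
      exact propext ⟨fun hy => ⟨hy.1, hy.2.1⟩, fun hy => ⟨hy.1, hy.2, hx⟩⟩
    rw [setIntegral_congr_set hae]
    refine setIntegral_eq_of_subset_of_forall_sdiff_eq_zero hBm inter_subset_left fun x hx => ?_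
    have : p x = 0 := by
      by_contra h0
      exact hx.2 ⟨hx.1, lt_of_le_of_ne (h.nonneg x) (Ne.symm h0)⟩
    rw [this, zero_smul]
  rw [h1, ← himage, integral_image_eq_integral_abs_det_fderiv_smul volume hm'
    (fun x hx => h.hasFDerivWithinAt_normalMap_splitCoords _ x hx.1)
    (h.injOn_normalMap_splitCoords.mono (preimage_mono inter_subset_left))]
  have h2 : ∫ x in splitCoords n ⁻¹' (normalDomain p Γ ℓ ζ ∩ Prod.fst ⁻¹' B),
      |((fderiv ℝ (normalMap Γ ζ) (splitCoords n x)).comp (splitCoords n)).det| •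
        (p ((normalMap Γ ζ ∘ splitCoords n) x) • ((normalMap Γ ζ ∘ splitCoords n) x -
          Γ (projIndex Γ ℓ ((normalMap Γ ζ ∘ splitCoords n) x)))) =
      ∫ x in splitCoordsEquiv n ⁻¹' (normalDomain p Γ ℓ ζ ∩ Prod.fst ⁻¹' B),
        weightedResidual p Γ ℓ ζ (splitCoordsEquiv n x) :=
    setIntegral_congr_fun hm' fun x hx => h.weightedResidual_of_mem hx.1
  refine h2.trans ?_
  rw [(measurePreserving_splitCoordsEquiv n).setIntegral_preimage_emb
    (splitCoordsEquiv n).measurableEmbedding (weightedResidual p Γ ℓ ζ)]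
  exact (setIntegral_eq_of_subset_of_forall_sdiff_eq_zero (measurable_fst hB) inter_subset_right
    fun q hq => weightedResidual_of_notMem fun hn => hq.2 ⟨hn, hq.1⟩).symm

end IsAdmissible

/-! ### Reduction to slices and comparison with the differential equation. -/

namespace IsAdmissible

variable {n : ℕ} {p : E n → ℝ} {Γ : ℝ → E n} {ℓ : ℝ} {ζ : ℝ → Fin n → ℝ}

theorem measurable_curve_projIndex (h : IsAdmissible p Γ ℓ ζ) :
    Measurable fun x => Γ (projIndex Γ ℓ x) := by
  have hc := h.curve.smooth.continuousOn
  have h1 : Continuous (IccExtend h.curve.length_pos.le ((Icc 0 ℓ).domRestrict Γ)) :=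
    (continuousOn_iff_continuous_domRestrict.1 hc).Icc_extend'
  have h2 : (fun x => Γ (projIndex Γ ℓ x)) =
      IccExtend h.curve.length_pos.le ((Icc 0 ℓ).domRestrict Γ) ∘ projIndex Γ ℓ :=
    funext fun x => (IccExtend_of_mem h.curve.length_pos.le ((Icc 0 ℓ).domRestrict Γ)
      (projIndex_mem h.curve.length_pos hc x).1).symm
  rw [h2]
  exact h1.measurable.comp (measurable_projIndex h.curve.length_pos hc)

theorem exists_norm_curve_projIndex_le (h : IsAdmissible p Γ ℓ ζ) :
    ∃ B, ∀ x, ‖Γ (projIndex Γ ℓ x)‖ ≤ B := by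
  obtain ⟨B, hB⟩ := (isCompact_Icc.image_of_continuousOn
    h.curve.smooth.continuousOn).isBounded.exists_norm_le
  exact ⟨B, fun x => hB _ (mem_image_of_mem Γ
    (projIndex_mem h.curve.length_pos h.curve.smooth.continuousOn x).1)⟩

theorem integrable_residual (h : IsAdmissible p Γ ℓ ζ) :
    Integrable fun x => p x • (x - Γ (projIndex Γ ℓ x)) := by
  obtain ⟨B, hB⟩ := h.exists_norm_curve_projIndex_le
  have hg : Integrable fun x : E n => p x * (‖x‖ + B) :=
    (h.continuous.mul (by fun_prop)).integrable_of_hasCompactSupport h.compact.mul_right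
  refine hg.mono' (h.continuous.measurable.smul (measurable_id.sub
    h.measurable_curve_projIndex)).aestronglyMeasurable (Eventually.of_forall fun x => ?_)
  rw [norm_smul, Real.norm_of_nonneg (h.nonneg x)]
  exact mul_le_mul_of_nonneg_left ((norm_sub_le _ _).trans (by gcongr; exact hB x)) (h.nonneg x)

theorem integrable_weightedResidual (h : IsAdmissible p Γ ℓ ζ) :
    Integrable (weightedResidual p Γ ℓ ζ) := by
  have hm : MeasurableSet (splitCoords n ⁻¹' normalDomain p Γ ℓ ζ) :=
    (splitCoords n).continuous.measurable h.isOpen_normalDomain.measurableSet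
  have h1 := (integrableOn_image_iff_integrableOn_abs_det_fderiv_smul volume hm
    (fun x hx => h.hasFDerivWithinAt_normalMap_splitCoords _ x hx)
    h.injOn_normalMap_splitCoords _).1 h.integrable_residual.integrableOn
  have h2 : IntegrableOn (weightedResidual p Γ ℓ ζ ∘ splitCoordsEquiv n)
      (splitCoordsEquiv n ⁻¹' normalDomain p Γ ℓ ζ) :=
    h1.congr_fun (fun x hx => h.weightedResidual_of_mem hx) hm
  rw [(measurePreserving_splitCoordsEquiv n).integrableOn_comp_preimage
    (splitCoordsEquiv n).measurableEmbedding] at h2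
  exact (integrableOn_iff_integrable_of_support_subset fun q hq => by
    by_contra hn
    exact hq (weightedResidual_of_notMem hn)).1 h2

/-- The integral of the `i`-th normal coordinate over the slice at `s`, weighted by the density
and the Jacobian. -/
def sliceResidual (p : E n → ℝ) (Γ : ℝ → E n) (ℓ : ℝ) (ζ : ℝ → Fin n → ℝ) (i : Fin n)
    (s : ℝ) : ℝ :=
  (∫ u, u i * sliceDensity p Γ ℓ ζ (s, u)) -
    ∑ j, (∫ u, u i * u j * sliceDensity p Γ ℓ ζ (s, u)) * curvature ℓ ζ s j

theorem integral_weightedResidual_slice (h : IsAdmissible p Γ ℓ ζ) (s : ℝ) :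
    ∫ u, weightedResidual p Γ ℓ ζ (s, u) =
      ∑ i, sliceResidual p Γ ℓ ζ i s • frameNormal (ζ s) i := by
  have hI : ∀ i, Integrable fun u : Fin n → ℝ => u i * sliceDensity p Γ ℓ ζ (s, u) := fun i =>
    h.integrable_mul_sliceDensity (by fun_prop) s
  have hJ : ∀ i j, Integrable fun u : Fin n → ℝ =>
      u i * u j * sliceDensity p Γ ℓ ζ (s, u) * curvature ℓ ζ s j := fun i j =>
    (h.integrable_mul_sliceDensity (f := fun u => u i * u j) (by fun_prop) s).mul_const _
  have hK : ∀ i, Integrable fun u : Fin n → ℝ => u i * sliceDensity p Γ ℓ ζ (s, u) -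
      ∑ j, u i * u j * sliceDensity p Γ ℓ ζ (s, u) * curvature ℓ ζ s j := fun i =>
    (hI i).sub (integrable_finsetSum _ fun j _ => hJ i j)
  have e : ∀ u : Fin n → ℝ, weightedResidual p Γ ℓ ζ (s, u) =
      ∑ i, (u i * sliceDensity p Γ ℓ ζ (s, u) -
        ∑ j, u i * u j * sliceDensity p Γ ℓ ζ (s, u) * curvature ℓ ζ s j) •
          frameNormal (ζ s) i := by
    intro u
    rw [weightedResidual, Finset.smul_sum]
    refine Finset.sum_congr rfl fun i _ => ?_
    rw [smul_smul]
    congr 1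
    rw [sub_mul, sub_mul, Finset.sum_mul, Finset.sum_mul]
    congr 1
    · ring
    · exact Finset.sum_congr rfl fun j _ => by ring
  simp_rw [e]
  rw [integral_finsetSum _ fun i _ => (hK i).smul_const _]
  refine Finset.sum_congr rfl fun i _ => ?_
  rw [integral_smul_const, integral_sub (hI i) (integrable_finsetSum _ fun j _ => hJ i j),
    integral_finsetSum _ fun j _ => hJ i j, sliceResidual]
  simp_rw [integral_mul_const]

theorem continuousAt_curvature (h : IsAdmissible p Γ ℓ ζ) (j : Fin n) {s : ℝ} (hs : s ∈ Ioo 0 ℓ) :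
    ContinuousAt (fun t => curvature ℓ ζ t j) s := by
  have hd : ContinuousAt (derivWithin ζ (Icc 0 ℓ)) s :=
    (h.angles.smooth.continuousOn_derivWithin (uniqueDiffOn_Icc h.curve.length_pos)
      (by simp)).continuousAt (Icc_mem_nhds hs.1 hs.2)
  exact (tendsto_pi_nhds.1 hd j).mul (ContinuousAt.comp
    (g := fun θ => ‖sphericalPartial θ j‖)
    (contDiff_sphericalPartial j).continuous.norm.continuousAt
    (h.hasDerivAt_angles hs).continuousAt)

theorem continuousAt_sliceResidual (h : IsAdmissible p Γ ℓ ζ) (i : Fin n) {s : ℝ}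
    (hs : s ∈ Ioo 0 ℓ) : ContinuousAt (sliceResidual p Γ ℓ ζ i) s :=
  (h.continuousAt_integral_mul_sliceDensity (f := fun u => u i) (by fun_prop) hs).sub
    (tendsto_finsetSum _ fun j _ => (h.continuousAt_integral_mul_sliceDensity
      (f := fun u => u i * u j) (by fun_prop) hs).mul (h.continuousAt_curvature j hs))

theorem sum_sliceResidual_eq_zero_iff (h : IsAdmissible p Γ ℓ ζ) {s : ℝ} (hs : s ∈ Ioo 0 ℓ) :
    ∑ i, sliceResidual p Γ ℓ ζ i s • frameNormal (ζ s) i = 0 ↔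
      ∀ i, sliceResidual p Γ ℓ ζ i s = 0 := by
  constructor
  · intro h0 i
    rw [← inner_sum_frameNormal (h.regular (Ioo_subset_Icc_self hs))
      (fun i => sliceResidual p Γ ℓ ζ i s) i, h0, inner_zero_left]
  · intro h0
    simp [h0]

theorem sliceDensity_eq_zero_of_notMem {s : ℝ} (hs : s ∉ Ioo 0 ℓ) (u : Fin n → ℝ) :
    sliceDensity p Γ ℓ ζ (s, u) = 0 :=
  indicator_of_notMem (fun hn => hs hn.1) _

/-- By Fubini, the integral over `B` is that of a vector function of `s`, whose components in the
independent normals are the `sliceResidual`s. -/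
theorem setIntegral_residual_eq_zero_iff (h : IsAdmissible p Γ ℓ ζ) :
    (∀ B, MeasurableSet B →
      ∫ x in projIndex Γ ℓ ⁻¹' B, p x • (x - Γ (projIndex Γ ℓ x)) = 0) ↔
      ∀ s ∈ Ioo 0 ℓ, ∀ i, sliceResidual p Γ ℓ ζ i s = 0 := by
  have hint := h.integrable_weightedResidual
  rw [Measure.volume_eq_prod] at hint
  have hG := hint.integral_prod_left
  have hfub : ∀ B, MeasurableSet B →
      ∫ x in projIndex Γ ℓ ⁻¹' B, p x • (x - Γ (projIndex Γ ℓ x)) =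
        ∫ s in B, ∫ u, weightedResidual p Γ ℓ ζ (s, u) := by
    intro B hB
    rw [h.setIntegral_projIndex_preimage hB, ← prod_univ, Measure.volume_eq_prod,
      setIntegral_prod _ hint.integrableOn]
    simp
  constructor
  · intro h0
    have hae := hG.ae_eq_zero_of_forall_setIntegral_eq_zero fun B hB _ => by
      rw [← hfub B hB, h0 B hB]
    intro s hs i
    have hae2 : sliceResidual p Γ ℓ ζ i =ᵐ[volume.restrict (Ioo 0 ℓ)] fun _ => (0 : ℝ) := by
      filter_upwards [ae_restrict_of_ae hae, ae_restrict_mem measurableSet_Ioo] with t ht htI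
      rw [h.integral_weightedResidual_slice, Pi.zero_apply,
        h.sum_sliceResidual_eq_zero_iff htI] at ht
      exact ht i
    -- Continuity upgrades "almost every `s`" to "every `s`".
    exact Measure.eqOn_open_of_ae_eq hae2 isOpen_Ioo
      (fun t ht => (h.continuousAt_sliceResidual i ht).continuousWithinAt) continuousOn_const hs
  · intro h0 B hB
    rw [hfub B hB]
    refine integral_eq_zero_of_ae (Eventually.of_forall fun s => ?_)
    by_cases hs : s ∈ Ioo 0 ℓ
    · simp [h.integral_weightedResidual_slice, h0 s hs]
    · simp [weightedResidual, sliceDensity_eq_zero_of_notMem hs]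

theorem isUnit_scaleMatrix (h : IsAdmissible p Γ ℓ ζ) {s : ℝ} (hs : s ∈ Icc 0 ℓ) :
    IsUnit (scaleMatrix (ζ s)) := by
  rw [Matrix.isUnit_iff_isUnit_det, scaleMatrix, Matrix.det_diagonal, isUnit_iff_ne_zero]
  exact Finset.prod_ne_zero_iff.2 fun i _ =>
    norm_ne_zero_iff.2 (sphericalPartial_ne_zero (h.regular hs) i)

theorem mem_Ioo_of_transverseMoment_ne_zero (h : IsAdmissible p Γ ℓ ζ) {s : ℝ}
    (hs : s ∈ Icc 0 ℓ) (h0 : transverseMoment p Γ ℓ ζ 0 s ≠ 0) : s ∈ Ioo 0 ℓ := by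
  by_contra hn
  rw [h.transverseMoment_zero hs] at h0
  simp [sliceDensity_eq_zero_of_notMem hn] at h0

/-- The slice of `normalDomain` is open with positive density, so `μ_0(s) = 0` forces it to be
empty. -/
theorem sliceResidual_eq_zero_of_transverseMoment (h : IsAdmissible p Γ ℓ ζ) {s : ℝ}
    (hs : s ∈ Icc 0 ℓ) (h0 : transverseMoment p Γ ℓ ζ 0 s = 0) (i : Fin n) :
    sliceResidual p Γ ℓ ζ i s = 0 := by
  have : ∀ u, sliceDensity p Γ ℓ ζ (s, u) = 0 := fun u =>
    indicator_of_notMem (fun hn => by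
      have := h.integral_sliceDensity_pos hn
      rw [← h.transverseMoment_zero hs] at this
      exact this.ne' h0) _
  simp [sliceResidual, this]

theorem sliceResidual_eq_zero_iff (h : IsAdmissible p Γ ℓ ζ) {s : ℝ}
    (hs : s ∈ Icc 0 ℓ) (h0 : transverseMoment p Γ ℓ ζ 0 s ≠ 0) :
    (∀ i, sliceResidual p Γ ℓ ζ i s = 0) ↔ derivWithin ζ (Icc 0 ℓ) s =
      (scaleMatrix (ζ s))⁻¹ *ᵥ ((odeMatrix p Γ ℓ ζ s)⁻¹ *ᵥ transverseMean p Γ ℓ ζ s) := by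
  have hM := (Matrix.isUnit_iff_isUnit_det _).1 (h.isUnit_odeMatrix hs h0)
  have hD := (Matrix.isUnit_iff_isUnit_det _).1 (h.isUnit_scaleMatrix hs)
  have hκ : scaleMatrix (ζ s) *ᵥ derivWithin ζ (Icc 0 ℓ) s = curvature ℓ ζ s := by
    ext j
    simp [scaleMatrix, Matrix.mulVec_diagonal, curvature, mul_comm]
  have hiff : (∀ i, sliceResidual p Γ ℓ ζ i s = 0) ↔
      transverseMean p Γ ℓ ζ s = odeMatrix p Γ ℓ ζ s *ᵥ curvature ℓ ζ s := by
    rw [funext_iff]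
    refine forall_congr' fun i => ?_
    simp only [sliceResidual, transverseMean, Matrix.mulVec, dotProduct, odeMatrix_apply,
      h.transverseMoment_single hs, h.transverseMoment_single_add_single hs, div_mul_eq_mul_div,
      ← Finset.sum_div]
    rw [div_left_inj' h0, sub_eq_zero]
  rw [hiff, ← hκ]
  constructor
  · intro he
    rw [he, Matrix.mulVec_mulVec _ (odeMatrix p Γ ℓ ζ s)⁻¹, Matrix.nonsing_inv_mul _ hM,
      Matrix.one_mulVec, Matrix.mulVec_mulVec, Matrix.nonsing_inv_mul _ hD, Matrix.one_mulVec]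
  · intro he
    conv_rhs => rw [he]
    simp [Matrix.mulVec_mulVec, Matrix.mul_nonsing_inv_cancel_left _ _ hD,
      Matrix.mul_nonsing_inv _ hM]

theorem solvesODE_iff (h : IsAdmissible p Γ ℓ ζ) :
    SolvesODE p Γ ℓ ζ ↔ ∀ s ∈ Ioo 0 ℓ, ∀ i, sliceResidual p Γ ℓ ζ i s = 0 := by
  constructor
  · intro hode s hs i
    have hsI := Ioo_subset_Icc_self hs
    by_cases h0 : transverseMoment p Γ ℓ ζ 0 s = 0
    · exact h.sliceResidual_eq_zero_of_transverseMoment hsI h0 i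
    · exact (h.sliceResidual_eq_zero_iff hsI h0).2 ((hode.angles s hsI h0).derivWithin
        (uniqueDiffOn_Icc h.curve.length_pos s hsI)) i
  · intro h0
    refine ⟨fun s hs => h.hasDerivWithinAt_curve hs, fun s hs hne => ?_⟩
    rw [← (h.sliceResidual_eq_zero_iff hs hne).1
      (h0 s (h.mem_Ioo_of_transverseMoment_ne_zero hs hne))]
    exact h.hasDerivWithinAt_angles hs

/-! ### Self-consistency as vanishing integrals. -/

section Probability

variable {Ω : Type*} [MeasurableSpace Ω] {P : Measure Ω} {X : Ω → E n}

theorem ae_mem_tsupport (h : IsAdmissible p Γ ℓ ζ) (hX : Measurable X)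
    (hd : P.map X = volume.withDensity fun x => ENNReal.ofReal (p x)) :
    ∀ᵐ w ∂P, X w ∈ tsupport p := by
  refine ae_of_ae_map hX.aemeasurable ?_
  rw [hd, ae_withDensity_iff h.continuous.measurable.ennreal_ofReal]
  refine Eventually.of_forall fun x hx => mem_tsupport ?_
  by_contra hn
  exact hx (ENNReal.ofReal_of_nonpos (not_lt.1 hn))

theorem setIntegral_sub_curve_projIndex (h : IsAdmissible p Γ ℓ ζ) (hX : Measurable X)
    (hd : P.map X = volume.withDensity fun x => ENNReal.ofReal (p x)) {B : Set ℝ}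
    (hB : MeasurableSet B) :
    ∫ w in (fun w => projIndex Γ ℓ (X w)) ⁻¹' B, (X w - Γ (projIndex Γ ℓ (X w))) ∂P =
      ∫ x in projIndex Γ ℓ ⁻¹' B, p x • (x - Γ (projIndex Γ ℓ x)) := by
  have hBm : MeasurableSet (projIndex Γ ℓ ⁻¹' B) :=
    measurable_projIndex h.curve.length_pos h.curve.smooth.continuousOn hB
  have h1 := setIntegral_map (μ := P) hBm
    (measurable_id.sub h.measurable_curve_projIndex).aestronglyMeasurable hX.aemeasurable
  refine h1.symm.trans ?_
  rw [hd, setIntegral_withDensity_eq_setIntegral_toReal_smul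
    h.continuous.measurable.ennreal_ofReal (by simp) _ hBm]
  simp [ENNReal.toReal_ofReal, h.nonneg]

/-- A conditional expectation given `λ(X)` is determined by its integrals over preimages
`λ(X)⁻¹(B)`; these are transported to `ℝ^d` through the density. -/
theorem selfConsistent_iff [IsProbabilityMeasure P] (h : IsAdmissible p Γ ℓ ζ) (hX : Measurable X)
    (hd : P.map X = volume.withDensity fun x => ENNReal.ofReal (p x)) :
    SelfConsistent P X Γ ℓ ↔ ∀ B, MeasurableSet B →
      ∫ x in projIndex Γ ℓ ⁻¹' B, p x • (x - Γ (projIndex Γ ℓ x)) = 0 := by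
  have hc := h.curve.smooth.continuousOn
  set Y : Ω → ℝ := fun w => projIndex Γ ℓ (X w) with hY
  have hYm : Measurable Y := (measurable_projIndex h.curve.length_pos hc).comp hX
  have hXi : Integrable X P := by
    obtain ⟨B, hB⟩ := h.compact.isBounded.exists_norm_le
    refine Integrable.of_bound hX.aestronglyMeasurable B ?_
    filter_upwards [h.ae_mem_tsupport hX hd] with w hw using hB _ hw
  have hΓi : Integrable (fun w => Γ (Y w)) P := by
    obtain ⟨B, hB⟩ := h.exists_norm_curve_projIndex_le
    exact Integrable.of_bound (h.measurable_curve_projIndex.comp hX).aestronglyMeasurable B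
      (Eventually.of_forall fun w => hB _)
  have hm : MeasurableSpace.comap Y (borel ℝ) ≤ ‹MeasurableSpace Ω› := by
    rw [← BorelSpace.measurable_eq (α := ℝ)]
    exact hYm.comap_le
  have hset : ∀ B, MeasurableSet B →
      (∫ w in Y ⁻¹' B, Γ (Y w) ∂P = ∫ w in Y ⁻¹' B, X w ∂P ↔
        ∫ x in projIndex Γ ℓ ⁻¹' B, p x • (x - Γ (projIndex Γ ℓ x)) = 0) := by
    intro B hB
    rw [← h.setIntegral_sub_curve_projIndex hX hd hB,
      integral_sub hXi.integrableOn hΓi.integrableOn, sub_eq_zero, eq_comm]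
  constructor
  · rintro ⟨φ, -, hφ, hφΓ⟩ B hB
    rw [← hset B hB, ← setIntegral_condExp hm hXi
      (s := Y ⁻¹' B) ⟨B, by rwa [← BorelSpace.measurable_eq (α := ℝ)], rfl⟩]
    refine setIntegral_congr_ae (hYm hB) ?_
    filter_upwards [hφ, ae_of_ae_map hYm.aemeasurable hφΓ] with w h1 h2 _
    rw [h1, h2]
  · intro h0
    -- `Γ` is arbitrary off `[0, ℓ]`, so a continuous extension, constant beyond each end, serves as
    -- the measurable factor.
    set φ := IccExtend h.curve.length_pos.le ((Icc 0 ℓ).domRestrict Γ) with hφ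
    have hφc : Continuous φ := (continuousOn_iff_continuous_domRestrict.1 hc).Icc_extend'
    have hφΓ : ∀ s ∈ Icc 0 ℓ, φ s = Γ s := fun s hs => IccExtend_of_mem _ _ hs
    have hφY : (fun w => φ (Y w)) = fun w => Γ (Y w) :=
      funext fun w => hφΓ _ (projIndex_mem h.curve.length_pos hc _).1
    refine ⟨φ, hφc.measurable, ?_, ?_⟩
    · change _ =ᵐ[P] fun w => φ (Y w)
      refine (ae_eq_condExp_of_forall_setIntegral_eq hm hXi (fun s _ _ => ?_) ?_ ?_).symm
      · rw [hφY]
        exact hΓi.integrableOn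
      · rintro _ ⟨B, hB, rfl⟩ _
        rw [← BorelSpace.measurable_eq (α := ℝ)] at hB
        rw [hφY, hset B hB]
        exact h0 B hB
      · refine StronglyMeasurable.aestronglyMeasurable ?_
        refine Measurable.stronglyMeasurable ?_
        refine hφc.measurable.comp ?_
        rw [← BorelSpace.measurable_eq (α := ℝ)]
        exact comap_measurable Y
    · refine (ae_map_iff hYm.aemeasurable measurableSet_Icc).2
        (Eventually.of_forall fun w => (projIndex_mem h.curve.length_pos hc (X w)).1) |>.mono hφΓ

end Probability

end IsAdmissible

end PrincipalCurve

end

theorem mainTheorem2 {n : ℕ} (hn : 1 ≤ n)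
    {Ω : Type*} [MeasurableSpace Ω] (P : Measure Ω) [IsProbabilityMeasure P]
    (X : Ω → PrincipalCurve.E n) (hX : Measurable X)
    (p : PrincipalCurve.E n → ℝ) (hp_nonneg : ∀ x, 0 ≤ p x) (hp_smooth : ContDiff ℝ ∞ p)
    (hp_density : P.map X = volume.withDensity (fun x => ENNReal.ofReal (p x)))
    (𝕏 : Set (PrincipalCurve.E n)) (h𝕏 : IsCompact 𝕏) (hp_supp : tsupport p = 𝕏)
    (hp_pos : ∀ x ∈ interior 𝕏, 0 < p x)
    (Γ : ℝ → PrincipalCurve.E n) (ℓ : ℝ) (hΓ : PrincipalCurve.IsSmoothJordanCurve Γ ℓ)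
    (hΓ𝕏 : MapsTo Γ (Icc 0 ℓ) 𝕏)
    (ζ : ℝ → Fin n → ℝ) (hζ : PrincipalCurve.IsSphericalRepresentation Γ ℓ ζ)
    (hν : PrincipalCurve.IsNormalDiffeo Γ ℓ ζ 𝕏) :
    (∀ s ∈ Icc 0 ℓ, IsUnit (PrincipalCurve.scaleMatrix (ζ s))) ∧
    (∀ s ∈ Icc 0 ℓ, Γ s ∈ interior 𝕏 → 0 < PrincipalCurve.transverseMoment p Γ ℓ ζ 0 s) ∧
    (∀ s ∈ Icc 0 ℓ, PrincipalCurve.transverseMoment p Γ ℓ ζ 0 s ≠ 0 →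
      IsUnit (PrincipalCurve.odeMatrix p Γ ℓ ζ s)) ∧
    (PrincipalCurve.SelfConsistent P X Γ ℓ ↔ PrincipalCurve.SolvesODE p Γ ℓ ζ) := by
  subst hp_supp
  have h : PrincipalCurve.IsAdmissible p Γ ℓ ζ :=
    ⟨hp_smooth.continuous, hp_nonneg, h𝕏, hΓ, hζ, hν⟩
  refine ⟨fun s hs => h.isUnit_scaleMatrix hs,
    fun s hs hsi => h.transverseMoment_zero_pos hs (hp_pos _ hsi),
    fun s hs h0 => h.isUnit_odeMatrix hs h0, ?_⟩
  rw [h.selfConsistent_iff hX hp_density, h.setIntegral_residual_eq_zero_iff, h.solvesODE_iff]
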